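/- **Sentences.** Let $\sigma$ be a vocabulary with unary predicates $U_1,\dots,U_n$ and binary predicates $R_1,\dots,R_m$. A $\mathrm{GP}^2$ sentence $\varphi$ over $\sigma$ in normal form is $$\varphi=\forall x\,\gamma(x)\ \wedge\bigwedge_{i\le m}\forall x\forall y\,\big((R_i(x,y)\wedge x\ne y)\to\alpha_i(x,y)\big)\ \wedge\bigwedge_{i\le n}\forall x\,\big(U_i(x)\to P_i(x)\big),$$ $$P_i(x)=\Big(\sum_{t\le m}\lambda_{i,t}\cdot\#_y[R_t(x,y)\wedge x\neq y]\ \circledast_i\ \delta_i\Big),$$ with $\gamma,\alpha_i$ quantifier-free, $\lambda_{i,t},\delta_i\in\mathbb Z$ and $\circledast_i\in\{=,\le,<,\ge,>\}$. It is finitely satisfiable if it has a finite nonempty model. **Types.** A 1-type is a maximal consistent set of literals over the atoms $U_i(x)$, $R_i(x,x)$. A 2-type is a maximal consistent set of literals over the atoms $R_i(x,y)$, $R_i(y,x)$. The dual $\bar\eta$ of a 2-type $\eta$ swaps $x$ and $y$. A 2-type is audible if it contains at least one positive literal. Let $T$ be the set of 1-types and $E^+$ the set of audible 2-types. A 1-type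 $\pi$ is compatible with $\varphi$ if $\pi(x)\models\gamma(x)$; let $T^\varphi\subseteq T$ be the set of these. A triple $\langle\pi_1,\eta,\pi_2\rangle$ is compatible with $\varphi$ if both $\pi_1(x)\wedge\eta(x,y)\wedge\pi_2(y)$ and $\pi_2(x)\wedge\bar\eta(x,y)\wedge\pi_1(y)$ entail $\bigwedge_i\big((R_i(x,y)\wedge x\ne y)\to\alpha_i(x,y)\big)$. **Characteristic system.** For a 1-type $\pi$, the system $\mathcal C^\varphi_\pi$ has variables $x_{\eta,\pi'}$ ($\eta\in E^+$, $\pi'\in T$) and the following constraints: - $x_{\eta,\pi'}=0$ whenever $\pi'$ or $\langle\pi,\eta,\pi'\rangle$ is not compatible with $\varphi$; - $\sum_t\lambda_{i,t}\sum_{\eta\in E^+,\,R_t(x,y)\in\eta}\ \sum_{\pi'\in T}x_{\eta,\pi'}\ \circledast_i\ \delta_i$ for each $i$ with $U_i(x)\in\pi$. Let $\mathcal B^\varphi_\pi$ be its set of solutions in $\mathbb N$. **Kleene-star system.** Let $A\mathbf x=\mathbf c$ be a system of $M$ integer equations in $N$ variables with a fixed order. Let $\|\cdot\|$ be the maximal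 absolute value of the entries, $L=((N+1)\|A\|+\|\mathbf c\|+1)^{M}$ and $D=N\|A\|L$. Consider the automaton over the letters $a_1,\dots,a_N$ whose states are an initial state, an accepting state, and all $\langle i,t,\mathbf v\rangle$ with $1\le i\le N$, $1\le t\le L$, $\mathbf v\in\{-D,\dots,D\}^{M}$. Its transitions reading $a_j$ are, with $A_j$ the $j$-th column of $A$: - from the initial state to $\langle j,1,A_j\rangle$, and also to the accepting state if $A_j=\mathbf c$; - from $\langle j,t,\mathbf v\rangle$ with $t<L$ to $\langle j,t+1,\mathbf v+A_j\rangle$, and also to the accepting state if $\mathbf v+A_j=\mathbf c$; - from $\langle i,t,\mathbf v\rangle$ with $i<j$ to $\langle j,1,\mathbf v+A_j\rangle$, and also to the accepting state if $\mathbf v+A_j=\mathbf c$ (transitions to states that do not exist are omitted). Let $B$ be the letters $\times$ transitions matrix with entry $1$ where the transition reads the letter and $0$ elsewhere. Let $F$ be the states $\times$ transitions matrix whose rows at the initial and the accepting state vanish and which in every other row has $1$ at the transitions entering the state, $-1$ at those leaving it and $0$ elsewhere. Put $\tilde A=\begin{pmatrix}-I&B\\0&F\end{pmatrix}$. The Kleene-star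 system of $A\mathbf x=\mathbf c$ is $$\exists\mathbf y_1,\mathbf y_2\ \ \mathbf x=\mathrm{proj}_N(\mathbf y_1)+\mathbf y_2\ \wedge\ \tilde A\mathbf y_1=\mathbf 0\ \wedge\ A\mathbf y_2=\mathbf 0\ \wedge\ (\mathbf y_1=\mathbf 0\to\mathbf y_2=\mathbf 0),$$ where $\mathbf y_1,\mathbf y_2$ range over vectors of natural numbers and $\mathrm{proj}_N$ takes the first $N$ entries. Let $\tilde{\mathcal C}^\varphi_\pi$ be the Kleene-star system of $\mathcal C^\varphi_\pi$, where each inequality of $\mathcal C^\varphi_\pi$ is first turned into an equation by a slack variable in $\mathbb N$ and the slack variables are existentially quantified in the resulting Kleene-star system. **The system $\mathcal Q^\varphi$.** Its variables are $x_{\pi_1,\eta,\pi_2}$ with $\pi_1,\pi_2\in T^\varphi$ and $\eta\in E^+$. It consists of: - (Structure) $\tilde{\mathcal C}^\varphi_\pi(\mathbf x_\pi)$ for every $\pi\in T^\varphi$, where $\mathbf x_\pi$ has the entry $x_{\pi,\eta,\pi'}$ at $(\eta,\pi')$ if $\pi'\in T^\varphi$ and $0$ if $\pi'\notin T^\varphi$;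 - (Matching) $x_{\pi_1,\eta,\pi_2}=x_{\pi_2,\bar\eta,\pi_1}$ for all $\pi_1,\pi_2\in T^\varphi$ and $\eta\in E^+$; - (Non-triviality) $\sum_{\pi_1,\eta,\pi_2}x_{\pi_1,\eta,\pi_2}>0$. **Lemma.** Let $\varphi$ be a $\mathrm{GP}^2$ sentence in normal form such that $\mathbf 0\notin\mathcal B^\varphi_\pi$ for every $\pi\in T^\varphi$. Then $\varphi$ is finitely satisfiable if and only if $\mathcal Q^\varphi$ has a solution in $\mathbb N$. -/

import Mathlib

noncomputable section

namespace GP2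

/-! ## Integer linear systems over the natural numbers -/

/-- The comparison signs that may occur in a linear constraint. -/
inductive Cmp
  | eq | le | lt | ge | gt
  deriving DecidableEq

/-- The meaning of a comparison sign. -/
def Cmp.Holds : Cmp → ℤ → ℤ → Prop
  | .eq, a, b => a = b
  | .le, a, b => a ≤ b
  | .lt, a, b => a < b
  | .ge, a, b => a ≥ b
  | .gt, a, b => a > b

/-- The coefficient of the slack variable that turns a comparison into an equation:
`a ≤ c` iff `a + s = c` for some `s ∈ ℕ`, and `a ≥ c` iff `a - s = c` for some `s ∈ ℕ`. -/
def Cmp.slackCoeff : Cmp → ℤ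
  | .eq => 0
  | .le => 1
  | .lt => 1
  | .ge => -1
  | .gt => -1

/-- Over the integers `a < c` is `a ≤ c - 1`, and `a > c` is `a ≥ c + 1`. -/
def Cmp.shift : Cmp → ℤ
  | .eq => 0
  | .le => 0
  | .lt => -1
  | .ge => 0
  | .gt => 1

/-- A finite system of linear constraints `(A x)_r ⊛_r c_r`, with constraints indexed by `κ`
and variables indexed by `ι`. -/
structure LinSystem (κ ι : Type) where
  /-- the coefficients -/
  A : Matrix κ ι ℤ
  /-- the comparison sign of each constraint -/
  rel : κ → Cmp
  /-- the constant of each constraint -/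
  c : κ → ℤ

/-- A vector of natural numbers, seen as a vector of integers. -/
def toInt {ι : Type} (x : ι → ℕ) : ι → ℤ := fun i => (x i : ℤ)

/-- The set of solutions in `ℕ`. -/
def LinSystem.sol {κ ι : Type} [Fintype ι] (S : LinSystem κ ι) : Set (ι → ℕ) :=
  {x | ∀ r, (S.rel r).Holds (S.A.mulVec (toInt x) r) (S.c r)}

/-- The indices of the slack variables: one for each constraint that is not an equation. -/
abbrev LinSystem.Slack {κ ι : Type} (S : LinSystem κ ι) : Type := {r : κ // S.rel r ≠ Cmp.eq}

open Classical in
/-- The coefficient matrix of the system of equations `A x + (slack) = c'`. -/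
def LinSystem.eqA {κ ι : Type} (S : LinSystem κ ι) : Matrix κ (ι ⊕ S.Slack) ℤ :=
  Matrix.fromCols S.A
    (Matrix.of fun r s => if s.1 = r then (S.rel r).slackCoeff else 0)

/-- The right-hand side of the system of equations `A x + (slack) = c'`. -/
def LinSystem.eqC {κ ι : Type} (S : LinSystem κ ι) : κ → ℤ :=
  fun r => S.c r + (S.rel r).shift

/-! ## The system describing the Kleene star of the solutions of `A x = c` -/

section Key

variable {κ ι : Type} [Fintype κ] [Fintype ι]

/-- `‖A‖`: the maximal absolute value of the entries of a matrix. -/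
def matNorm (A : Matrix κ ι ℤ) : ℕ :=
  Finset.univ.sup fun p : κ × ι => (A p.1 p.2).natAbs

/-- `‖c‖`: the maximal absolute value of the entries of a vector. -/
def vecNorm (c : κ → ℤ) : ℕ :=
  Finset.univ.sup fun r : κ => (c r).natAbs

/-- `L = ((n + 1) ‖A‖ + ‖c‖ + 1) ^ m`, for `m` equations in `n` variables. -/
def boundL (A : Matrix κ ι ℤ) (c : κ → ℤ) : ℕ :=
  ((Fintype.card ι + 1) * matNorm A + vecNorm c + 1) ^ Fintype.card κ

/-- `D = n ‖A‖ L`. -/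
def boundD (A : Matrix κ ι ℤ) (c : κ → ℤ) : ℕ :=
  Fintype.card ι * matNorm A * boundL A c

/-- A fixed ordering of the variables, that is, of the letters `a_i` of the automaton. -/
def pos (i : ι) : Fin (Fintype.card ι) := Fintype.equivFin ι i

/-- The states of the automaton of `A x = c`: an initial state, an accepting state, and
the states `⟨i, t, v⟩` with `1 ≤ t ≤ L` and `v ∈ {-D, …, D} ^ m`. In the state `⟨i, t, v⟩` the last
letter read is `a_i`, it has been read `t` times, and `A` times the Parikh vector of the word read
so far is `v`. -/
inductive State (A : Matrix κ ι ℤ) (c : κ → ℤ) : Type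
  | init : State A c
  | mid (i : ι) (t : Finset.Icc 1 (boundL A c))
      (v : κ → Finset.Icc (-(boundD A c : ℤ)) (boundD A c : ℤ)) : State A c
  | acc : State A c

/-- The transitions of the automaton. It accepts the words of `a_1^* a_2^* ⋯ a_n^*`
whose Parikh vector `x` is nonzero with entries at most `L` and satisfies `A x = c`. -/
def Step (A : Matrix κ ι ℤ) (c : κ → ℤ) : State A c → ι → State A c → Prop
  | .init, j, .mid j' t' v' =>
      j' = j ∧ t'.1 = 1 ∧ ∀ r, (v' r).1 = A r j
  | .init, j, .acc =>
      ∀ r, A r j = c r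
  | .mid i t v, j, .mid j' t' v' =>
      j' = j ∧ (∀ r, (v' r).1 = (v r).1 + A r j) ∧
        ((i = j ∧ t'.1 = t.1 + 1) ∨ (pos i < pos j ∧ t'.1 = 1))
  | .mid i t v, j, .acc =>
      (∀ r, (v r).1 + A r j = c r) ∧
        ((i = j ∧ t.1 + 1 ≤ boundL A c) ∨ pos i < pos j)
  | _, _, _ => False

/-- The set of transitions `(p, a_j, q)`. -/
abbrev Trans (A : Matrix κ ι ℤ) (c : κ → ℤ) : Type :=
  {e : State A c × ι × State A c // Step A c e.1 e.2.1 e.2.2}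

instance (A : Matrix κ ι ℤ) (c : κ → ℤ) : Finite (State A c) := by
  let f : Option (Option (ι × Finset.Icc 1 (boundL A c) ×
      (κ → Finset.Icc (-(boundD A c : ℤ)) (boundD A c : ℤ)))) → State A c := fun s =>
    match s with
    | none => State.init
    | some none => State.acc
    | some (some p) => State.mid p.1 p.2.1 p.2.2
  refine Finite.of_surjective f ?_
  rintro (_ | ⟨i, t, v⟩ | _)
  · exact ⟨none, rfl⟩
  · exact ⟨some (some (i, t, v)), rfl⟩
  · exact ⟨some none, rfl⟩

instance (A : Matrix κ ι ℤ) (c : κ → ℤ) : Fintype (State A c) := Fintype.ofFinite _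

instance (A : Matrix κ ι ℤ) (c : κ → ℤ) : Fintype (Trans A c) := Fintype.ofFinite _

open Classical in
/-- The letter-incidence matrix `B` of the automaton. -/
def labelMat (A : Matrix κ ι ℤ) (c : κ → ℤ) : Matrix ι (Trans A c) ℤ :=
  Matrix.of fun i e => if e.1.2.1 = i then 1 else 0

open Classical in
/-- The flow-conservation matrix of the automaton: the rows of the initial and the accepting state
vanish, and every other state has entry `1` at its incoming and `-1` at its outgoing transitions. -/
def flowMat (A : Matrix κ ι ℤ) (c : κ → ℤ) : Matrix (State A c) (Trans A c) ℤ :=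
  Matrix.of fun q e =>
    if q = State.init ∨ q = State.acc then 0
    else if e.1.2.2 = q then 1
    else if e.1.1 = q then -1
    else 0

open Classical in
/-- The block matrix `Ã = [-I, B; 0, A_M]`. -/
def tildeA (A : Matrix κ ι ℤ) (c : κ → ℤ) : Matrix (ι ⊕ State A c) (ι ⊕ Trans A c) ℤ :=
  Matrix.fromBlocks (-1) (labelMat A c) 0 (flowMat A c)

/-- `x` is a solution in `ℕ` of the system
`∃ y₁ y₂, x = proj y₁ + y₂ ∧ Ã y₁ = 0 ∧ A y₂ = 0 ∧ (y₁ = 0 → y₂ = 0)`. -/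
def TildeSol (A : Matrix κ ι ℤ) (c : κ → ℤ) (x : ι → ℕ) : Prop :=
  ∃ (y₁ : ι ⊕ Trans A c → ℕ) (y₂ : ι → ℕ),
    (∀ i, x i = y₁ (Sum.inl i) + y₂ i) ∧
    (tildeA A c).mulVec (toInt y₁) = 0 ∧
    A.mulVec (toInt y₂) = 0 ∧
    (y₁ = 0 → y₂ = 0)

end Key

/-- The same system for a system with inequalities: the slack variables of the
associated system of equations are existentially quantified. -/
def LinSystem.TildeSol {κ ι : Type} [Fintype κ] [Fintype ι] (S : LinSystem κ ι)
    (x : ι → ℕ) : Prop :=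
  ∃ s : S.Slack → ℕ, GP2.TildeSol S.eqA S.eqC (Sum.elim x s)

/-! ## Vocabulary, sentences in normal form, and finite satisfiability -/

/-- The predicate symbols: unary `U_1, …, U_n` and binary `R_1, …, R_m`. -/
inductive Pred (n m : ℕ) : ℕ → Type
  | U (i : Fin n) : Pred n m 1
  | R (i : Fin m) : Pred n m 2

/-- The vocabulary with the predicates `U_1, …, U_n`, `R_1, …, R_m` and no function symbols. -/
abbrev voc (n m : ℕ) : FirstOrder.Language.{0, 0} := ⟨fun _ => Empty, Pred n m⟩

/-- `U_i(a)` holds in the structure. -/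
def HoldsU {n m : ℕ} {M : Type} [(voc n m).Structure M] (i : Fin n) (a : M) : Prop :=
  FirstOrder.Language.Structure.RelMap (L := voc n m) (Pred.U i) ![a]

/-- `R_i(a, b)` holds in the structure. -/
def HoldsR {n m : ℕ} {M : Type} [(voc n m).Structure M] (i : Fin m) (a b : M) : Prop :=
  FirstOrder.Language.Structure.RelMap (L := voc n m) (Pred.R i) ![a, b]

/-- A sentence
`∀x γ(x) ∧ ⋀_{i ≤ m} ∀x ∀y ((R_i(x,y) ∧ x ≠ y) → α_i(x,y)) ∧ ⋀_{i ≤ n} ∀x (U_i(x) → P_i(x))`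
in normal form, where
`P_i(x) = (∑_t λ_{i,t} · #_y[R_t(x,y) ∧ x ≠ y] ⊛_i δ_i)`. In `γ` the variable `x` is `0`, and
in `α_i` the variables `x`, `y` are `0`, `1`. -/
structure NormalForm (n m : ℕ) where
  /-- the unary universal part -/
  γ : (voc n m).Formula (Fin 1)
  γ_qf : γ.IsQF
  /-- the binary universal part -/
  α : Fin m → (voc n m).Formula (Fin 2)
  α_qf : ∀ i, (α i).IsQF
  /-- the coefficients of the Presburger quantifiers -/
  coeff : Fin n → Fin m → ℤ
  /-- the comparison signs of the Presburger quantifiers -/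
  rel : Fin n → Cmp
  /-- the constants of the Presburger quantifiers -/
  δ : Fin n → ℤ

namespace NormalForm

variable {n m : ℕ}

/-- The finite structure `M` is a model of `φ`. -/
def Models (φ : NormalForm n m) (M : Type) [Finite M] [(voc n m).Structure M] : Prop :=
  (∀ a : M, φ.γ.Realize ![a]) ∧
  (∀ i, ∀ a b : M, HoldsR (n := n) i a b ∧ a ≠ b → (φ.α i).Realize ![a, b]) ∧
  (∀ i, ∀ a : M, HoldsU (m := m) i a →
    (φ.rel i).Holds
      (∑ t, φ.coeff i t * (Nat.card {b : M // HoldsR (n := n) t a b ∧ a ≠ b} : ℤ)) (φ.δ i))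

/-- `φ` has a finite (nonempty) model. -/
def FinitelySatisfiable (φ : NormalForm n m) : Prop :=
  ∃ (M : Type) (_ : Finite M) (_ : Nonempty M) (_ : (voc n m).Structure M), φ.Models M

end NormalForm

/-! ## Types -/

/-- 1-types, as truth assignments to the atoms `U_i(x)` (first component) and
`R_i(x, x)` (second component). -/
abbrev OneTp (n m : ℕ) : Type := (Fin n → Bool) × (Fin m → Bool)

/-- 2-types, as truth assignments to the atoms `R_i(x, y)` (first component) and
`R_i(y, x)` (second component). -/
abbrev TwoTp (m : ℕ) : Type := (Fin m → Bool) × (Fin m → Bool)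

/-- The silent 2-type, in which all atoms are negated. -/
def silent (m : ℕ) : TwoTp m := (fun _ => false, fun _ => false)

/-- The audible 2-types. -/
abbrev AudTp (m : ℕ) : Type := {η : TwoTp m // η ≠ silent m}

/-- The dual of a 2-type, with `x` and `y` swapped. -/
def dual {m : ℕ} (η : TwoTp m) : TwoTp m := (η.2, η.1)

theorem dual_ne_silent {m : ℕ} {η : TwoTp m} (h : η ≠ silent m) : dual η ≠ silent m :=
  fun e => h (Prod.ext (congrArg Prod.snd e) (congrArg Prod.fst e))

/-- The dual of an audible 2-type is audible. -/
def AudTp.dual {m : ℕ} (η : AudTp m) : AudTp m := ⟨GP2.dual η.1, dual_ne_silent η.2⟩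

/-- The element `a` of a structure has 1-type `π`. -/
def HasOneTp {n m : ℕ} {M : Type} [(voc n m).Structure M] (a : M) (π : OneTp n m) : Prop :=
  (∀ i, π.1 i = true ↔ HoldsU (m := m) i a) ∧ (∀ i, π.2 i = true ↔ HoldsR (n := n) i a a)

/-- The pair `(a, b)` of elements of a structure has 2-type `η`. -/
def HasTwoTp {m : ℕ} (n : ℕ) {M : Type} [(voc n m).Structure M] (a b : M) (η : TwoTp m) : Prop :=
  (∀ i, η.1 i = true ↔ HoldsR (n := n) i a b) ∧ (∀ i, η.2 i = true ↔ HoldsR (n := n) i b a)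

namespace NormalForm

variable {n m : ℕ} (φ : NormalForm n m)

/-- The 1-type `π` is compatible with `φ`: `π(x) ⊨ γ(x)`. -/
def Compat₁ (π : OneTp n m) : Prop :=
  ∀ (M : Type) [Finite M] [(voc n m).Structure M] (a : M),
    HasOneTp a π → φ.γ.Realize ![a]

/-- `π₁(x) ∧ η(x,y) ∧ π₂(y) ⊨ ⋀_i ((R_i(x,y) ∧ x ≠ y) → α_i(x,y))`. -/
def Entails₂ (π₁ : OneTp n m) (η : TwoTp m) (π₂ : OneTp n m) : Prop :=
  ∀ (M : Type) [Finite M] [(voc n m).Structure M] (a b : M),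
    HasOneTp a π₁ → HasTwoTp n a b η → HasOneTp b π₂ →
      ∀ i, HoldsR (n := n) i a b ∧ a ≠ b → (φ.α i).Realize ![a, b]

/-- The triple `⟨π₁, η, π₂⟩` is compatible with `φ`. -/
def Compat₂ (π₁ : OneTp n m) (η : TwoTp m) (π₂ : OneTp n m) : Prop :=
  φ.Entails₂ π₁ η π₂ ∧ φ.Entails₂ π₂ (dual η) π₁

/-- The set of 1-types that are compatible with `φ`. -/
abbrev CompatTp : Type := {π : OneTp n m // φ.Compat₁ π}

instance : Fintype φ.CompatTp := Fintype.ofFinite _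

/-! ## The characteristic system and the system `Q^φ` -/

/-- The constraints of the characteristic system of `φ` and `π`: one for each pair `(η, π')` that
violates compatibility, and one for each `i` with `U_i(x) ∈ π`. -/
abbrev CharRow (π : OneTp n m) : Type :=
  {p : AudTp m × OneTp n m // ¬ (φ.Compat₁ p.2 ∧ φ.Compat₂ π p.1.1 p.2)} ⊕
    {i : Fin n // π.1 i = true}

instance (π : OneTp n m) : Fintype (φ.CharRow π) := Fintype.ofFinite _

/-- The characteristic system of `φ` and `π`, in the variables `x_{η, π'}`, with constraints
`x_{η, π'} = 0` if `π'` or `⟨π, η, π'⟩` is not compatible with `φ`, and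
`(∑_t λ_{i,t} ∑_{η ∋ R_t(x,y)} ∑_{π'} x_{η, π'}) ⊛_i δ_i` if `U_i(x) ∈ π`. -/
def charSystem (π : OneTp n m) : LinSystem (φ.CharRow π) (AudTp m × OneTp n m) where
  A := Matrix.of fun r q => match r with
    | .inl p => if q = p.1 then 1 else 0
    | .inr i => ∑ t, φ.coeff i.1 t * (if q.1.1.1 t = true then 1 else 0)
  rel := fun r => match r with
    | .inl _ => Cmp.eq
    | .inr i => φ.rel i.1
  c := fun r => match r with
    | .inl _ => 0
    | .inr i => φ.δ i.1

/-- The set of behavior vectors that are compatible with `φ` and `π`. -/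
def behaviors (π : OneTp n m) : Set (AudTp m × OneTp n m → ℕ) := (φ.charSystem π).sol

open Classical in
/-- The vector `x_π` of the variables `x_{π, η, π'}`, as a vector over all pairs `(η, π')`;
there are no variables for the 1-types `π'` that are not compatible with `φ`, and their entries
are `0`. -/
def row (x : φ.CompatTp → AudTp m → φ.CompatTp → ℕ) (π : φ.CompatTp) :
    AudTp m × OneTp n m → ℕ :=
  fun p => if h : φ.Compat₁ p.2 then x π p.1 ⟨p.2, h⟩ else 0

/-- `x` is a solution in `ℕ` of the system `Q^φ`. -/
structure IsSolutionQ (x : φ.CompatTp → AudTp m → φ.CompatTp → ℕ) : Prop where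
  /-- Structure: `x_π` solves the system obtained from the characteristic system of `φ` and `π`. -/
  structural : ∀ π : φ.CompatTp, (φ.charSystem π.1).TildeSol (φ.row x π)
  /-- Matching -/
  matching : ∀ (π₁ : φ.CompatTp) (η : AudTp m) (π₂ : φ.CompatTp), x π₁ η π₂ = x π₂ η.dual π₁
  /-- Non-triviality -/
  nontrivial : 0 < ∑ π₁ : φ.CompatTp, ∑ η : AudTp m, ∑ π₂ : φ.CompatTp, x π₁ η π₂

end NormalForm

end GP2

end

/-!
Whether a finite structure is a model of `φ` depends only on the 1-type and the behavior of each
element, where the behavior counts the neighbors of each kind. If no `behaviors π` contains `0`,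
every element of a model lies on an edge, so it suffices to characterize the models with an edge.
Summing the behaviors of the elements of each 1-type `π` gives a vector in the submonoid generated
by `behaviors π`; counting each edge from both of its ends gives the matching condition. Conversely,
a solution of `Q^φ` is a sum of behaviors, and matching lets one pair up the required edge ends,
except that an end which looks the same from both sides may be paired with itself. The resulting
multigraph on `V` is turned into a structure by passing to the covering `V × (ℤ/4)^D`, for `D` the
set of edge ends: different ends move the second coordinate by different nonzero elements, and
partners by opposite ones, so the covering has neither loops nor multiple edges, and its vertices
have the behaviors prescribed on `V`.

The Kleene-star system of `A x = c` describes the submonoid generated by the solutions of `A x = c`: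
since the automaton reads the letters in a fixed order and counts repetitions, it has no cycles, so
a flow is a sum of accepting runs, and these read off exactly the nonzero solutions with entries at
most `L`. By a pigeonhole argument every nonzero solution is one of these plus an element of the
kernel of `A`.
-/

noncomputable section

namespace GP2

/-! ### Small solutions of integer systems -/

section NatMulVec

variable {κ ι : Type} [Fintype ι]

/-- The map `x ↦ A x` on vectors of natural numbers. -/
def natMulVec (A : Matrix κ ι ℤ) : (ι → ℕ) →+ (κ → ℤ) where
  toFun x := A.mulVec (toInt x)
  map_zero' := by simp [toInt, Matrix.mulVec_eq_sum]
  map_add' x y := by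
    rw [← Matrix.mulVec_add]
    exact congrArg _ (funext fun i => Nat.cast_add _ _)

theorem natMulVec_apply (A : Matrix κ ι ℤ) (x : ι → ℕ) (r : κ) :
    natMulVec A x r = ∑ i, A r i * x i := rfl

theorem natMulVec_single [DecidableEq ι] (A : Matrix κ ι ℤ) (i : ι) :
    natMulVec A (Pi.single i 1) = A.col i := by
  ext r
  simp [natMulVec_apply, Pi.single_apply]

end NatMulVec

theorem natAbs_le_matNorm {κ ι : Type} [Fintype κ] [Fintype ι] (A : Matrix κ ι ℤ) (r : κ)
    (i : ι) : (A r i).natAbs ≤ matNorm A :=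
  Finset.le_sup (f := fun p : κ × ι => (A p.1 p.2).natAbs) (Finset.mem_univ (r, i))

theorem natAbs_le_vecNorm {κ : Type} [Fintype κ] (c : κ → ℤ) (r : κ) :
    (c r).natAbs ≤ vecNorm c :=
  Finset.le_sup (f := fun r => (c r).natAbs) (Finset.mem_univ r)

theorem mul_mem_Icc_posPart {a t q : ℤ} (h0 : 0 ≤ t) (hq : t ≤ q) :
    a * t ∈ Set.Icc (-(q * a⁻)) (q * a⁺) := by
  have hpos : t * a⁺ ≤ q * a⁺ := mul_le_mul_of_nonneg_right hq (posPart_nonneg a)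
  have hneg : t * a⁻ ≤ q * a⁻ := mul_le_mul_of_nonneg_right hq (negPart_nonneg a)
  have hpos0 := mul_nonneg h0 (posPart_nonneg a)
  have hneg0 := mul_nonneg h0 (negPart_nonneg a)
  have ha : a * t = t * a⁺ - t * a⁻ := by rw [← mul_sub, posPart_sub_negPart, mul_comm]
  constructor <;> linarith

section SmallSolutions

variable {κ ι : Type} [Fintype ι]

/-- The range of `s c_r - (A f)_r` for `s ∈ [0, 1]` and `f ∈ [0, 1] ^ ι`: it contains the `r`-th
entry of `A z` for each lattice point `z` obtained by rounding down a point of the segment from `0`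
to a solution of `A x = c`. -/
def box (A : Matrix κ ι ℤ) (c : κ → ℤ) (r : κ) : Finset ℤ :=
  Finset.Icc (-∑ i, (A r i)⁺ - (c r)⁻) (∑ i, (A r i)⁻ + (c r)⁺)

theorem card_box_le [Fintype κ] (A : Matrix κ ι ℤ) (c : κ → ℤ) (r : κ) :
    (box A c r).card ≤ (Fintype.card ι + 1) * matNorm A + vecNorm c + 1 := by
  have hA : ∑ i, (A r i)⁺ + ∑ i, (A r i)⁻ ≤ Fintype.card ι * matNorm A := by
    rw [← Finset.sum_add_distrib]
    refine (Finset.sum_le_card_nsmul _ _ (matNorm A : ℤ) fun i _ => ?_).trans (by simp)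
    rw [posPart_add_negPart, Int.abs_eq_natAbs]
    exact_mod_cast natAbs_le_matNorm A r i
  have hc : (c r)⁺ + (c r)⁻ ≤ vecNorm c := by
    rw [posPart_add_negPart, Int.abs_eq_natAbs]
    exact_mod_cast natAbs_le_vecNorm c r
  rw [box, Int.card_Icc, Int.toNat_le]
  push_cast
  linarith [Int.natCast_nonneg (matNorm A)]

theorem natMulVec_floor_mem_box {A : Matrix κ ι ℤ} {c : κ → ℤ} {x : ι → ℕ}
    (hx : natMulVec A x = c) {q j : ℕ} (hj : j < q) (r : κ) :
    natMulVec A (fun i => j * x i / q) r ∈ box A c r := by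
  have hq : (0 : ℤ) < q := by omega
  have hmul : q * natMulVec A (fun i => j * x i / q) r =
      c r * j - ∑ i, A r i * ((j * x i % q : ℕ) : ℤ) := by
    rw [← hx]
    simp only [natMulVec_apply, Finset.mul_sum, Finset.sum_mul, ← Finset.sum_sub_distrib]
    refine Finset.sum_congr rfl fun i _ => ?_
    have hdiv : (q * (j * x i / q : ℕ) + (j * x i % q : ℕ) : ℤ) = j * x i := by
      exact_mod_cast Nat.div_add_mod (j * x i) q
    linear_combination A r i * hdiv
  have hc := mul_mem_Icc_posPart (a := c r) (Int.natCast_nonneg j) (by omega : (j : ℤ) ≤ q)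
  have hrem (i : ι) : A r i * ((j * x i % q : ℕ) : ℤ) ∈
      Set.Icc (-(q * (A r i)⁻)) (q * (A r i)⁺) :=
    mul_mem_Icc_posPart (Int.natCast_nonneg _) (by exact_mod_cast (Nat.mod_lt _ (by omega)).le)
  have hlo := Finset.sum_le_sum fun i (_ : i ∈ Finset.univ) => (hrem i).1
  have hhi := Finset.sum_le_sum fun i (_ : i ∈ Finset.univ) => (hrem i).2
  rw [Finset.sum_neg_distrib, ← Finset.mul_sum] at hlo
  rw [← Finset.mul_sum] at hhi
  refine Finset.mem_Icc.mpr ⟨le_of_mul_le_mul_left ?_ hq, le_of_mul_le_mul_left ?_ hq⟩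
  · rw [hmul, mul_sub, mul_neg]
    linarith [hc.1]
  · rw [hmul, mul_add]
    linarith [hc.2]

/-- Two of the `x k` roundings of the points `(j / x k) x` have the same image under `A`. -/
theorem exists_homogeneous_lt [Fintype κ] {A : Matrix κ ι ℤ} {c : κ → ℤ} {x : ι → ℕ} {k : ι}
    (hk : boundL A c < x k) (hx : natMulVec A x = c) :
    ∃ d, 0 < d ∧ d < x ∧ natMulVec A d = 0 := by
  classical
  let z : ℕ → ι → ℕ := fun j i => j * x i / x k
  have hz (j : ℕ) : z j k = j := Nat.mul_div_cancel _ (by omega)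
  have hcard : (Fintype.piFinset (box A c)).card < (Finset.range (x k)).card := by
    rw [Fintype.card_piFinset, Finset.card_range]
    refine (Finset.prod_le_pow_card _ _ _ fun r _ => card_box_le A c r).trans_lt ?_
    rwa [Finset.card_univ]
  obtain ⟨j, hj, j', hj', hne, heq⟩ := Finset.exists_ne_map_eq_of_card_lt_of_maps_to hcard
    (f := fun j => natMulVec A (z j)) fun j hj =>
      Fintype.mem_piFinset.mpr (natMulVec_floor_mem_box hx (Finset.mem_range.mp hj))
  rw [Finset.mem_range] at hj hj'
  wlog hlt : j < j' generalizing j j'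
  · exact this j' hj' j hj hne.symm heq.symm (by omega)
  have hmono : z j ≤ z j' := fun i => Nat.div_le_div_right (Nat.mul_le_mul_right _ hlt.le)
  have hzx : z j' ≤ x := fun i => Nat.div_le_of_le_mul (Nat.mul_le_mul_right _ hj'.le)
  refine ⟨z j' - z j, ?_, ?_, ?_⟩
  · refine tsub_pos_of_lt (hmono.lt_of_ne fun h => hlt.ne ?_)
    rw [← hz j, h, hz]
  · refine (tsub_le_self.trans hzx).lt_of_ne fun h => ?_
    have hk := congrFun h k
    rw [Pi.sub_apply, hz, hz] at hk
    omega
  · have hsum := congrArg (natMulVec A) (tsub_add_cancel_of_le hmono)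
    rw [map_add] at hsum
    exact add_eq_right.mp (hsum.trans heq.symm)

theorem exists_small_solution_le [Fintype κ] {A : Matrix κ ι ℤ} {c : κ → ℤ} {x : ι → ℕ}
    (hx0 : x ≠ 0) (hx : natMulVec A x = c) :
    ∃ p ≤ x, p ≠ 0 ∧ natMulVec A p = c ∧ ∀ i, p i ≤ boundL A c := by
  obtain ⟨p, hpx, ⟨hp0, hp⟩, hmin⟩ := exists_minimal_le_of_wellFoundedLT
    (fun p => p ≠ 0 ∧ natMulVec A p = c) x ⟨hx0, hx⟩
  refine ⟨p, hpx, hp0, hp, fun k => not_lt.mp fun hk => ?_⟩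
  obtain ⟨d, hd0, hdp, hd⟩ := exists_homogeneous_lt hk hp
  have hsolves : natMulVec A (p - d) = c := by
    rw [← hp, ← congrArg (natMulVec A) (tsub_add_cancel_of_le hdp.le), map_add, hd, add_zero]
  have hle := hmin ⟨(tsub_pos_of_lt hdp).ne', hsolves⟩ tsub_le_self
  rw [le_tsub_iff_right hdp.le, add_le_iff_nonpos_right] at hle
  exact hd0.not_ge hle

end SmallSolutions

/-! ### The automaton of a system of equations -/

theorem exists_eq_add_single {α : Type*} [DecidableEq α] {y : α → ℕ} {e : α} (he : y e ≠ 0) :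
    ∃ z : α → ℕ, y = z + Pi.single e 1 := by
  refine ⟨y - Pi.single e 1, (tsub_add_cancel_of_le fun b => ?_).symm⟩
  rcases eq_or_ne b e with rfl | hb
  · rw [Pi.single_eq_same]
    exact Nat.one_le_iff_ne_zero.mpr he
  · rw [Pi.single_eq_of_ne hb]
    exact Nat.zero_le _

theorem exists_eq_add_single_last {α β : Type*} [Finite α] [DecidableEq α] [LinearOrder β]
    (f : α → β) {p : α → ℕ} (hp : p ≠ 0) :
    ∃ (z : α → ℕ) (i : α), p = z + Pi.single i 1 ∧ ∀ j, f i < f j → z j = 0 := by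
  obtain ⟨i, hi, hmax⟩ := (Set.toFinite {i | p i ≠ 0}).exists_maximalFor f _
    (Function.ne_iff.mp hp)
  obtain ⟨z, rfl⟩ := exists_eq_add_single hi
  refine ⟨z, i, rfl, fun j hij => by_contra fun hj => hij.not_ge (hmax ?_ hij.le)⟩
  simp [hj]

section Automaton

variable {κ ι : Type} [Fintype κ] [Fintype ι] {A : Matrix κ ι ℤ} {c : κ → ℤ}

namespace State

open Classical in
/-- The excess of the incoming over the outgoing flow when a unit of flow ends in the given state;
as in `flowMat`, it is not recorded at the initial and the accepting state. -/
def unit (q : State A c) : State A c → ℤ :=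
  fun s => if s = init ∨ s = acc then 0 else if q = s then 1 else 0

theorem unit_init : (init : State A c).unit = 0 := by
  ext s
  cases s <;> simp [unit]

theorem unit_acc : (acc : State A c).unit = 0 := by
  ext s
  cases s <;> simp [unit]

/-- A rank that increases along all transitions, so that the automaton has no cycles. -/
def rank : State A c → ℕ ×ₗ ℕ
  | init => toLex (0, 0)
  | mid i t _ => toLex (pos i + 1, t.1)
  | acc => toLex (Fintype.card ι + 1, 0)

/-- The value of `A` at the Parikh vector of a word that leads to the given state. -/
def value : State A c → κ → ℤ
  | init => 0
  | mid _ _ v => fun r => v r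
  | acc => c

/-- The state is the one reached by the word of `a_1^* ⋯ a_n^*` with Parikh vector `p` after each
of its letters has been read, without a final move to the accepting state. -/
def Records (p : ι → ℕ) : State A c → Prop
  | init => p = 0
  | mid i t v => p i = t.1 ∧ (∀ j, pos i < pos j → p j = 0) ∧ ∀ r, (v r).1 = natMulVec A p r
  | acc => False

end State

namespace Step

variable {q q' : State A c} {j : ι}

theorem rank_lt (h : Step A c q j q') : q.rank < q'.rank := by
  have hpos (i : ι) := (pos i).2
  rcases q with _ | ⟨i, t, v⟩ | _ <;> rcases q' with _ | ⟨i', t', v'⟩ | _ <;>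
    simp only [Step, State.rank, Prod.Lex.toLex_lt_toLex] at h ⊢
  · omega
  · omega
  · obtain ⟨rfl, -, ⟨rfl, ht⟩ | ⟨hlt, -⟩⟩ := h
    · omega
    · exact Or.inl (Nat.succ_lt_succ hlt)
  · exact Or.inl (Nat.succ_lt_succ (hpos i))

theorem value_eq (h : Step A c q j q') : q'.value = q.value + A.col j := by
  ext r
  rcases q with _ | ⟨i, t, v⟩ | _ <;> rcases q' with _ | ⟨i', t', v'⟩ | _ <;>
    simp only [Step, State.value, Pi.add_apply, Matrix.col_apply, Pi.zero_apply, zero_add] at h ⊢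
  · exact h.2.2 r
  · exact (h r).symm
  · exact h.2.1 r
  · exact (h.1 r).symm

theorem src_ne_acc (h : Step A c q j q') : q ≠ .acc := by
  rintro rfl
  exact h

theorem tgt_ne_init (h : Step A c q j q') : q' ≠ .init := by
  rintro rfl
  cases q <;> exact h

end Step

/-! ### Flows in the automaton -/

open Classical in
/-- The Parikh vector of a flow: the number of times that each letter is read. -/
def parikh : (Trans A c → ℕ) →ₗ[ℕ] (ι → ℕ) :=
  Fintype.linearCombination ℕ fun e => Pi.single e.1.2.1 1

open Classical in
theorem parikh_single (e : Trans A c) : parikh (Pi.single e 1) = Pi.single e.1.2.1 1 := by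
  rw [parikh, Fintype.linearCombination_apply_single, one_smul]

theorem parikh_apply (y : Trans A c → ℕ) (i : ι) :
    (parikh y i : ℤ) = natMulVec (labelMat A c) y i := by
  classical
  simp [parikh, Fintype.linearCombination_apply, natMulVec_apply, labelMat, Pi.single_comm _ _ i,
    Pi.single_apply]

theorem flowMat_col (e : Trans A c) : (flowMat A c).col e = e.1.2.2.unit - e.1.1.unit := by
  have hne : e.1.1 ≠ e.1.2.2 := fun h => e.2.rank_lt.ne (congrArg _ h)
  ext s
  simp only [Matrix.col_apply, flowMat, Matrix.of_apply, Pi.sub_apply, State.unit]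
  split_ifs with _ htgt hsrc
  · rfl
  · exact absurd (hsrc.trans htgt.symm) hne
  all_goals rfl

theorem exists_tgt_eq_of_natMulVec_flowMat {y : Trans A c → ℕ}
    (hy : natMulVec (flowMat A c) y = 0) {e : Trans A c} (he : y e ≠ 0) (hinit : e.1.1 ≠ .init) :
    ∃ e', y e' ≠ 0 ∧ e'.1.2.2 = e.1.1 := by
  have hsum := congrFun hy e.1.1
  rw [natMulVec_apply, Pi.zero_apply] at hsum
  have hne : e.1.2.2 ≠ e.1.1 := fun h => e.2.rank_lt.ne' (congrArg _ h)
  obtain ⟨e', -, he'⟩ := Finset.exists_pos_of_sum_zero_of_exists_nonzero _ hsum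
    ⟨e, Finset.mem_univ e, by simp [flowMat, hinit, e.2.src_ne_acc, hne, he]⟩
  refine ⟨e', fun h => by simp [h] at he', by_contra fun htgt => he'.not_ge ?_⟩
  refine mul_nonpos_of_nonpos_of_nonneg ?_ (Int.natCast_nonneg _)
  simp only [flowMat, Matrix.of_apply, htgt, if_false]
  split_ifs <;> decide

/-- A transition of the flow whose source has least rank starts in the initial state. -/
theorem exists_src_eq_init {y : Trans A c → ℕ} (hy : natMulVec (flowMat A c) y = 0)
    (hy0 : y ≠ 0) : ∃ e, y e ≠ 0 ∧ e.1.1 = .init := by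
  obtain ⟨e, he, hmin⟩ := (Set.toFinite {e | y e ≠ 0}).exists_minimalFor
    (fun e : Trans A c => e.1.1.rank) _ (Function.ne_iff.mp hy0)
  refine ⟨e, he, by_contra fun hinit => ?_⟩
  obtain ⟨e', he', htgt⟩ := exists_tgt_eq_of_natMulVec_flowMat hy he hinit
  have hlt : e'.1.1.rank < e.1.1.rank := htgt ▸ e'.2.rank_lt
  exact hlt.not_ge (hmin he' hlt.le)

theorem exists_src_eq {y : Trans A c → ℕ} {q : State A c}
    (hy : natMulVec (flowMat A c) y q < 0) : ∃ e, y e ≠ 0 ∧ e.1.1 = q := by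
  rw [natMulVec_apply] at hy
  obtain ⟨e, -, he⟩ := Finset.exists_lt_of_sum_lt (hy.trans_eq Finset.sum_const_zero.symm)
  refine ⟨e, fun h => by simp [h] at he, by_contra fun hsrc => he.not_ge ?_⟩
  refine mul_nonneg ?_ (Int.natCast_nonneg _)
  simp only [flowMat, Matrix.of_apply, hsrc, if_false]
  split_ifs <;> decide

open Classical in
theorem natMulVec_flowMat_single (e : Trans A c) :
    natMulVec (flowMat A c) (Pi.single e 1) = e.1.2.2.unit - e.1.1.unit := by
  rw [natMulVec_single, flowMat_col]

/-- A flow in which a unit starts at `q` contains a run from `q` to the accepting state. -/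
theorem exists_run (y : Trans A c → ℕ) (q : State A c) (hq : q ≠ .init)
    (hy : natMulVec (flowMat A c) y = -q.unit) :
    ∃ f z, y = f + z ∧ natMulVec (flowMat A c) z = 0 ∧
      q.value + natMulVec A (parikh f) = c := by
  classical
  induction y using WellFoundedLT.induction generalizing q with
  | _ y ih =>
  rcases q with _ | ⟨i, t, v⟩ | _
  · exact absurd rfl hq
  · obtain ⟨e, he, hsrc⟩ := exists_src_eq (y := y) (q := .mid i t v) (by simp [hy, State.unit])
    obtain ⟨y, rfl⟩ := exists_eq_add_single he
    have hlt : y < y + Pi.single e 1 := lt_add_of_pos_right _ (Pi.single_pos.mpr one_pos)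
    rw [map_add, natMulVec_flowMat_single, hsrc] at hy
    obtain ⟨f, z, rfl, hz, hf⟩ := ih y hlt e.1.2.2 e.2.tgt_ne_init
      (by linear_combination (exp := 1) hy)
    refine ⟨f + Pi.single e 1, z, add_right_comm _ _ _, hz, ?_⟩
    rw [e.2.value_eq, hsrc] at hf
    rw [map_add, parikh_single, map_add, natMulVec_single, add_comm (natMulVec A _), ← add_assoc,
      hf]
  · rw [State.unit_acc, neg_zero] at hy
    exact ⟨0, y, (zero_add y).symm, hy, by simp [State.value]⟩

theorem exists_accepting_run {y : Trans A c → ℕ} (hy : natMulVec (flowMat A c) y = 0)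
    (hy0 : y ≠ 0) :
    ∃ f z, y = f + z ∧ f ≠ 0 ∧ natMulVec (flowMat A c) z = 0 ∧ natMulVec A (parikh f) = c := by
  classical
  obtain ⟨e, he, hsrc⟩ := exists_src_eq_init hy hy0
  obtain ⟨y, rfl⟩ := exists_eq_add_single he
  rw [map_add, natMulVec_flowMat_single, hsrc, State.unit_init] at hy
  obtain ⟨f, z, rfl, hz, hf⟩ := exists_run y e.1.2.2 e.2.tgt_ne_init
    (by linear_combination (exp := 1) hy)
  refine ⟨f + Pi.single e 1, z, add_right_comm _ _ _, by simp, hz, ?_⟩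
  rw [e.2.value_eq, hsrc, State.value, zero_add] at hf
  rw [map_add, parikh_single, map_add, natMulVec_single, add_comm, hf]

theorem parikh_mem_closure (y : Trans A c → ℕ) (hy : natMulVec (flowMat A c) y = 0) :
    parikh y ∈ AddSubmonoid.closure {p | natMulVec A p = c} := by
  induction y using WellFoundedLT.induction with
  | _ y ih =>
  rcases eq_or_ne y 0 with rfl | hy0
  · rw [map_zero]
    exact zero_mem _
  obtain ⟨f, z, rfl, hf0, hz, hf⟩ := exists_accepting_run hy hy0
  rw [map_add]
  exact add_mem (AddSubmonoid.subset_closure hf)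
    (ih z (lt_add_of_pos_left z (pos_iff_ne_zero.mpr hf0)) hz)

/-! ### Runs of the automaton on small solutions -/

theorem natMulVec_mem_Icc_boundD {p : ι → ℕ} (hp : ∀ i, p i ≤ boundL A c) (r : κ) :
    natMulVec A p r ∈ Finset.Icc (-(boundD A c : ℤ)) (boundD A c) := by
  rw [Finset.mem_Icc, ← abs_le, natMulVec_apply]
  calc |∑ i, A r i * (p i : ℤ)| ≤ ∑ i, |A r i * (p i : ℤ)| := Finset.abs_sum_le_sum_abs _ _
    _ ≤ ∑ _i : ι, (matNorm A * boundL A c : ℤ) := by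
        refine Finset.sum_le_sum fun i _ => ?_
        rw [abs_mul, Nat.abs_cast, Int.abs_eq_natAbs]
        exact_mod_cast Nat.mul_le_mul (natAbs_le_matNorm A r i) (hp i)
    _ = boundD A c := by simp [boundD, mul_assoc]

namespace State.Records

variable {p : ι → ℕ} {q : State A c} {i : ι}

theorem last_letter {j : ι} {t : Finset.Icc 1 (boundL A c)}
    {v : κ → Finset.Icc (-(boundD A c : ℤ)) (boundD A c : ℤ)} (h : (mid j t v).Records p)
    (hlast : ∀ k, pos i < pos k → p k = 0) : j = i ∧ p i = t ∨ pos j < pos i ∧ p i = 0 := by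
  have ht := (Finset.mem_Icc.mp t.2).1
  rcases lt_trichotomy (pos j) (pos i) with hlt | heq | hgt
  · exact Or.inr ⟨hlt, h.2.1 i hlt⟩
  · obtain rfl := (Fintype.equivFin ι).injective heq
    exact Or.inl ⟨rfl, h.1⟩
  · have := h.1.symm.trans (hlast j hgt)
    omega

open Classical in
theorem step_acc (h : q.Records p) (hlast : ∀ k, pos i < pos k → p k = 0)
    (hp : p i + 1 ≤ boundL A c) (hsol : natMulVec A (p + Pi.single i 1) = c) :
    Step A c q i acc := by
  have hsol (r : κ) : natMulVec A p r + A r i = c r := by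
    rw [← congrFun hsol r, map_add, natMulVec_single, Pi.add_apply, Matrix.col_apply]
  rcases q with _ | ⟨j, t, v⟩ | _
  · obtain rfl : p = 0 := h
    exact fun r => by simpa only [map_zero, Pi.zero_apply, zero_add] using hsol r
  · refine ⟨fun r => by rw [h.2.2, hsol], ?_⟩
    rcases h.last_letter hlast with ⟨rfl, ht⟩ | ⟨hlt, -⟩
    · exact Or.inl ⟨rfl, ht ▸ hp⟩
    · exact Or.inr hlt
  · exact h.elim

open Classical in
theorem exists_step_mid (h : q.Records p) (hlast : ∀ k, pos i < pos k → p k = 0)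
    (hp : ∀ k, (p + Pi.single i 1 : ι → ℕ) k ≤ boundL A c) :
    ∃ q', Step A c q i q' ∧ q'.Records (p + Pi.single i 1) := by
  have hval (r : κ) : natMulVec A (p + Pi.single i 1) r = natMulVec A p r + A r i := by
    rw [map_add, natMulVec_single, Pi.add_apply, Matrix.col_apply]
  have hi : (p + Pi.single i 1 : ι → ℕ) i = p i + 1 := by simp
  refine ⟨mid i ⟨p i + 1, Finset.mem_Icc.mpr ⟨Nat.le_add_left _ _, hi ▸ hp i⟩⟩
    fun r => ⟨_, natMulVec_mem_Icc_boundD hp r⟩, ?_, hi, fun j hij => ?_, fun r => rfl⟩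
  · rcases q with _ | ⟨j, t, v⟩ | _
    · obtain rfl : p = 0 := h
      exact ⟨rfl, rfl, fun r => (hval r).trans (by rw [map_zero, Pi.zero_apply, zero_add])⟩
    · refine ⟨rfl, fun r => by rw [h.2.2, ← hval], ?_⟩
      rcases h.last_letter hlast with ⟨rfl, ht⟩ | ⟨hlt, h0⟩
      · exact Or.inl ⟨rfl, congrArg (· + 1) ht⟩
      · exact Or.inr ⟨hlt, congrArg (· + 1) h0⟩
    · exact h.elim
  · have hne : j ≠ i := fun hji => hij.ne (congrArg pos hji.symm)
    simp [hlast j hij, hne]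

end State.Records

/-- There is a unit of flow from the initial state to `q` with Parikh vector `p`. -/
def State.Reachable (q : State A c) (p : ι → ℕ) : Prop :=
  ∃ f : Trans A c → ℕ, natMulVec (flowMat A c) f = q.unit ∧ parikh f = p

open Classical in
theorem State.Reachable.step {q q' : State A c} {p : ι → ℕ} {j : ι} (h : q.Reachable p)
    (hstep : Step A c q j q') : q'.Reachable (p + Pi.single j 1) := by
  obtain ⟨f, hf, rfl⟩ := h
  refine ⟨f + Pi.single ⟨(q, j, q'), hstep⟩ 1, ?_, by rw [map_add, parikh_single]⟩
  rw [map_add, natMulVec_flowMat_single, hf, add_sub_cancel]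

theorem exists_reachable_records (p : ι → ℕ) (hp : ∀ i, p i ≤ boundL A c) :
    ∃ q : State A c, q.Reachable p ∧ q.Records p := by
  classical
  induction p using WellFoundedLT.induction with
  | _ p ih =>
  rcases eq_or_ne p 0 with rfl | hp0
  · exact ⟨.init, ⟨0, by rw [map_zero, State.unit_init], map_zero _⟩, rfl⟩
  obtain ⟨z, i, rfl, hlast⟩ := exists_eq_add_single_last pos hp0
  obtain ⟨q, hreach, hrec⟩ := ih z (lt_add_of_pos_right _ (Pi.single_pos.mpr one_pos))
    fun k => le_trans (by simp) (hp k)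
  obtain ⟨q', hstep, hrec'⟩ := hrec.exists_step_mid hlast hp
  exact ⟨q', hreach.step hstep, hrec'⟩

theorem reachable_acc {p : ι → ℕ} (hp0 : p ≠ 0) (hp : ∀ i, p i ≤ boundL A c)
    (hsol : natMulVec A p = c) : (State.acc : State A c).Reachable p := by
  classical
  obtain ⟨z, i, rfl, hlast⟩ := exists_eq_add_single_last pos hp0
  obtain ⟨q, hreach, hrec⟩ := exists_reachable_records z fun k => le_trans (by simp) (hp k)
  exact hreach.step (hrec.step_acc hlast (by simpa using hp i) hsol)

/-! ### The Kleene-star system -/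

theorem natMulVec_tildeA_eq_zero_iff (y : ι ⊕ Trans A c → ℕ) :
    natMulVec (tildeA A c) y = 0 ↔
      parikh (y ∘ Sum.inr) = y ∘ Sum.inl ∧ natMulVec (flowMat A c) (y ∘ Sum.inr) = 0 := by
  have hl (i : ι) : natMulVec (tildeA A c) y (.inl i) = parikh (y ∘ Sum.inr) i - y (.inl i) := by
    classical
    rw [parikh_apply]
    simp [natMulVec_apply, tildeA, Matrix.one_apply, neg_add_eq_sub]
  have hr (q : State A c) :
      natMulVec (tildeA A c) y (.inr q) = natMulVec (flowMat A c) (y ∘ Sum.inr) q := by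
    simp [natMulVec_apply, tildeA]
  simp only [funext_iff, Sum.forall, hl, hr, Pi.zero_apply, sub_eq_zero, Nat.cast_inj,
    Function.comp_apply]

theorem tildeSol_iff_exists_flow {x : ι → ℕ} :
    TildeSol A c x ↔ ∃ (f : Trans A c → ℕ) (y : ι → ℕ), x = parikh f + y ∧
      natMulVec (flowMat A c) f = 0 ∧ natMulVec A y = 0 ∧ (f = 0 → y = 0) := by
  constructor
  · rintro ⟨y₁, y, hx, hy₁, hy, h0⟩
    obtain ⟨hl, hr⟩ := (natMulVec_tildeA_eq_zero_iff y₁).mp hy₁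
    refine ⟨y₁ ∘ Sum.inr, y, hl ▸ funext hx, hr, hy, fun hf => h0 ?_⟩
    rw [hf, map_zero] at hl
    exact funext (Sum.forall.mpr ⟨fun i => (congrFun hl i).symm, congrFun hf⟩)
  · rintro ⟨f, y, rfl, hf, hy, h0⟩
    exact ⟨Sum.elim (parikh f) f, y, fun _ => rfl,
      (natMulVec_tildeA_eq_zero_iff _).mpr ⟨rfl, hf⟩, hy, fun h => h0 (congrArg (· ∘ Sum.inr) h)⟩

theorem TildeSol.zero : TildeSol A c 0 :=
  tildeSol_iff_exists_flow.mpr ⟨0, 0, by simp, map_zero _, map_zero _, fun _ => rfl⟩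

theorem TildeSol.add {x x' : ι → ℕ} (h : TildeSol A c x) (h' : TildeSol A c x') :
    TildeSol A c (x + x') := by
  rw [tildeSol_iff_exists_flow] at h h' ⊢
  obtain ⟨f, y, rfl, hf, hy, h0⟩ := h
  obtain ⟨f', y', rfl, hf', hy', h0'⟩ := h'
  refine ⟨f + f', y + y', ?_, ?_, ?_, fun h => ?_⟩
  · rw [map_add, add_add_add_comm]
  · rw [map_add, hf, hf', add_zero]
  · rw [map_add, hy, hy', add_zero]
  · obtain ⟨hf0, hf0'⟩ := add_eq_zero.mp h
    rw [h0 hf0, h0' hf0', add_zero]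

theorem tildeSol_of_natMulVec_eq {x : ι → ℕ} (hx : natMulVec A x = c) : TildeSol A c x := by
  rcases eq_or_ne x 0 with rfl | hx0
  · exact TildeSol.zero
  obtain ⟨p, hpx, hp0, hsol, hp⟩ := exists_small_solution_le hx0 hx
  obtain ⟨f, hf, rfl⟩ := reachable_acc hp0 hp hsol
  have hsum := add_tsub_cancel_of_le hpx
  refine tildeSol_iff_exists_flow.mpr ⟨f, x - parikh f, hsum.symm, hf.trans State.unit_acc, ?_,
    fun h => absurd (h ▸ map_zero parikh) hp0⟩
  rw [← hsum, map_add, hsol] at hx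
  exact add_eq_left.mp hx

/-- The solution `y` of the homogeneous system is added to one of the solutions that the flow `f`
decomposes into: there is one, as `f ≠ 0` if `y ≠ 0`. -/
theorem TildeSol.mem_closure {x : ι → ℕ} (h : TildeSol A c x) :
    x ∈ AddSubmonoid.closure {p | natMulVec A p = c} := by
  obtain ⟨f, y, rfl, hf, hy, h0⟩ := tildeSol_iff_exists_flow.mp h
  rcases eq_or_ne f 0 with rfl | hf0
  · rw [h0 rfl, map_zero, add_zero]
    exact zero_mem _
  · obtain ⟨g, z, rfl, -, hz, hg⟩ := exists_accepting_run hf hf0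
    have hgy : natMulVec A (parikh g + y) = c := by rw [map_add, hg, hy, add_zero]
    rw [map_add, add_right_comm]
    exact add_mem (AddSubmonoid.subset_closure hgy) (parikh_mem_closure z hz)

theorem tildeSol_iff_mem_closure {x : ι → ℕ} :
    TildeSol A c x ↔ x ∈ AddSubmonoid.closure {p | natMulVec A p = c} := by
  refine ⟨TildeSol.mem_closure, fun h => ?_⟩
  induction h using AddSubmonoid.closure_induction with
  | mem _ hx => exact tildeSol_of_natMulVec_eq hx
  | zero => exact TildeSol.zero
  | add _ _ _ _ hx hy => exact hx.add hy

end Automaton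

/-! ### Slack variables -/

theorem Cmp.holds_iff_exists_slack (r : Cmp) (a b : ℤ) :
    r.Holds a b ↔ ∃ s : ℕ, a + r.slackCoeff * s = b + r.shift := by
  cases r <;> simp only [Holds, slackCoeff, shift]
  case eq => simp
  case le => exact ⟨fun h => ⟨(b - a).toNat, by lia⟩, fun ⟨s, hs⟩ => by lia⟩
  case lt => exact ⟨fun h => ⟨(b - 1 - a).toNat, by lia⟩, fun ⟨s, hs⟩ => by lia⟩
  case ge => exact ⟨fun h => ⟨(a - b).toNat, by lia⟩, fun ⟨s, hs⟩ => by lia⟩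
  case gt => exact ⟨fun h => ⟨(a - b - 1).toNat, by lia⟩, fun ⟨s, hs⟩ => by lia⟩

namespace LinSystem

variable {κ ι : Type} [Fintype κ] [Fintype ι] (S : LinSystem κ ι)

theorem natMulVec_eqA (x : ι → ℕ) (s : κ → ℕ) (r : κ) :
    natMulVec S.eqA (Sum.elim x fun q : S.Slack => s q) r =
      natMulVec S.A x r + (S.rel r).slackCoeff * s r := by
  classical
  have hslack : ∑ q : S.Slack, (if q.1 = r then (S.rel r).slackCoeff else 0) * (s q : ℤ) =
      (S.rel r).slackCoeff * s r := by
    by_cases hr : S.rel r = .eq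
    · rw [hr]
      simp [Cmp.slackCoeff]
    · refine (Fintype.sum_eq_single (⟨r, hr⟩ : S.Slack) fun q hq => ?_).trans (by simp)
      rw [if_neg fun h => hq (Subtype.ext h), zero_mul]
  simpa [natMulVec_apply, eqA] using hslack

theorem mem_sol_iff {x : ι → ℕ} :
    x ∈ S.sol ↔ ∃ s, natMulVec S.eqA (Sum.elim x s) = S.eqC := by
  rw [(Subtype.val_injective.surjective_comp_right (γ := ℕ)).exists]
  simp only [funext_iff, Function.comp_def, natMulVec_eqA]
  rw [← Classical.skolem (p := fun r (s : ℕ) => _ + _ * (s : ℤ) = _)]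
  exact forall_congr' fun r => Cmp.holds_iff_exists_slack _ _ _

theorem tildeSol_iff_mem_closure {x : ι → ℕ} :
    S.TildeSol x ↔ x ∈ AddSubmonoid.closure S.sol := by
  have himage : LinearMap.funLeft ℕ ℕ Sum.inl '' {p | natMulVec S.eqA p = S.eqC} = S.sol := by
    ext y
    rw [mem_sol_iff]
    exact ⟨fun ⟨p, hp, hy⟩ => ⟨p ∘ Sum.inr, hy ▸ Sum.elim_comp_inl_inr p ▸ hp⟩,
      fun ⟨s, hs⟩ => ⟨_, hs, rfl⟩⟩
  rw [← himage, ← AddMonoidHom.coe_coe, ← AddMonoidHom.map_mclosure, AddSubmonoid.mem_map]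
  simp only [← GP2.tildeSol_iff_mem_closure]
  exact ⟨fun ⟨s, hs⟩ => ⟨_, hs, rfl⟩,
    fun ⟨p, hp, hx⟩ => ⟨p ∘ Sum.inr, hx ▸ (Sum.elim_comp_inl_inr p).symm ▸ hp⟩⟩

end LinSystem

/-! ### Types of elements and quantifier-free formulas -/

section Realize

open FirstOrder.Language.Structure (RelMap)

theorem realize_iff_of_isQF {L : FirstOrder.Language} [L.IsRelational] {M N α : Type*}
    [L.Structure M] [L.Structure N] {ψ : L.Formula α} (hψ : ψ.IsQF) {v : α → M} {w : α → N}
    (heq : ∀ i j, v i = v j ↔ w i = w j)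
    (hrel : ∀ (k : ℕ) (R : L.Relations k) (f : Fin k → α),
      RelMap R (fun i => v (f i)) ↔ RelMap R fun i => w (f i)) :
    ψ.Realize v ↔ ψ.Realize w := by
  have hvar (t : L.Term (α ⊕ Fin 0)) : ∃ i, t = .var (.inl i) := by
    obtain ⟨i | i⟩ | ⟨f, -⟩ := t
    · exact ⟨i, rfl⟩
    · exact i.elim0
    · exact isEmptyElim f
  unfold FirstOrder.Language.Formula.Realize
  induction hψ with
  | falsum => exact Iff.rfl
  | of_isAtomic h =>
    cases h with
    | equal t₁ t₂ =>
      obtain ⟨i, rfl⟩ := hvar t₁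
      obtain ⟨j, rfl⟩ := hvar t₂
      simpa using heq i j
    | rel R ts =>
      choose f hf using fun k => hvar (ts k)
      simpa [FirstOrder.Language.BoundedFormula.realize_rel, hf] using hrel _ R f
  | imp _ _ ih₁ ih₂ => exact imp_congr ih₁ ih₂

variable {n m : ℕ} {M N : Type} [(voc n m).Structure M] [(voc n m).Structure N]

theorem relMap_U_iff (i : Fin n) (v : Fin 1 → M) :
    RelMap (L := voc n m) (Pred.U i) v ↔ HoldsU (m := m) i (v 0) := by
  rw [HoldsU, (funext (Fin.forall_fin_one.mpr rfl) : ![v 0] = v)]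

theorem relMap_R_iff (i : Fin m) (v : Fin 2 → M) :
    RelMap (L := voc n m) (Pred.R i) v ↔ HoldsR (n := n) i (v 0) (v 1) := by
  rw [HoldsR, (funext (Fin.forall_fin_two.mpr ⟨rfl, rfl⟩) : ![v 0, v 1] = v)]

theorem realize_iff_of_hasOneTp {ψ : (voc n m).Formula (Fin 1)} (hψ : ψ.IsQF) {a : M} {b : N}
    {π : OneTp n m} (ha : HasOneTp a π) (hb : HasOneTp b π) :
    ψ.Realize ![a] ↔ ψ.Realize ![b] := by
  refine realize_iff_of_isQF hψ (fun i j => by simp [Subsingleton.elim i j]) fun k R f => ?_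
  rcases R with i | i
  · simp [relMap_U_iff, ← ha.1, ← hb.1]
  · simp [relMap_R_iff, ← ha.2, ← hb.2]

theorem realize_iff_of_hasTwoTp {ψ : (voc n m).Formula (Fin 2)} (hψ : ψ.IsQF) {a b : M}
    {a' b' : N} {π₁ π₂ : OneTp n m} {η : TwoTp m} (ha : HasOneTp a π₁) (ha' : HasOneTp a' π₁)
    (hab : HasTwoTp n a b η) (hab' : HasTwoTp n a' b' η) (hb : HasOneTp b π₂)
    (hb' : HasOneTp b' π₂) (hne : a ≠ b) (hne' : a' ≠ b') :
    ψ.Realize ![a, b] ↔ ψ.Realize ![a', b'] := by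
  refine realize_iff_of_isQF hψ ?_ fun k R f => ?_
  · simp [Fin.forall_fin_two, hne, hne', hne.symm, hne'.symm]
  rcases R with i | i
  · have hU (j : Fin 2) : HoldsU (m := m) i (![a, b] j) ↔ HoldsU (m := m) i (![a', b'] j) := by
      fin_cases j
      · exact (ha.1 i).symm.trans (ha'.1 i)
      · exact (hb.1 i).symm.trans (hb'.1 i)
    simpa only [relMap_U_iff] using hU (f 0)
  · have hR (j l : Fin 2) : HoldsR (n := n) i (![a, b] j) (![a, b] l) ↔
        HoldsR (n := n) i (![a', b'] j) (![a', b'] l) := by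
      fin_cases j <;> fin_cases l
      · exact (ha.2 i).symm.trans (ha'.2 i)
      · exact (hab.1 i).symm.trans (hab'.1 i)
      · exact (hab.2 i).symm.trans (hab'.2 i)
      · exact (hb.2 i).symm.trans (hb'.2 i)
    simpa only [relMap_R_iff] using hR (f 0) (f 1)

end Realize

/-! ### Behaviors in finite structures -/

section Types

open Classical in
/-- The 1-type of an element. -/
def oneTp (n m : ℕ) {M : Type} [(voc n m).Structure M] (a : M) : OneTp n m :=
  (fun i => decide (HoldsU (m := m) i a), fun i => decide (HoldsR (n := n) i a a))

open Classical in
/-- The 2-type of a pair of elements. -/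
def twoTp (n m : ℕ) {M : Type} [(voc n m).Structure M] (a b : M) : TwoTp m :=
  (fun i => decide (HoldsR (n := n) i a b), fun i => decide (HoldsR (n := n) i b a))

variable {n m : ℕ} {M : Type} [(voc n m).Structure M]

/-- `a` is joined to `b`, with audible 2-type `q.1` of `(a, b)` and with 1-type `q.2` of `b`. -/
def Sees (a : M) (q : AudTp m × OneTp n m) (b : M) : Prop :=
  a ≠ b ∧ twoTp n m a b = q.1.1 ∧ oneTp n m b = q.2

/-- The behavior of an element: the number of elements that it sees in each way. In an infinite
structure an infinite number is replaced by `0`. -/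
def behavior (n m : ℕ) {M : Type} [(voc n m).Structure M] (a : M) : AudTp m × OneTp n m → ℕ :=
  fun q => Nat.card {b // Sees a q b}

theorem decide_eq_iff_iff {p : Prop} [Decidable p] {b : Bool} :
    decide p = b ↔ (b = true ↔ p) := by
  cases b <;> simp

theorem hasOneTp_iff {a : M} {π : OneTp n m} : HasOneTp a π ↔ oneTp n m a = π := by
  simp only [HasOneTp, oneTp, Prod.ext_iff, funext_iff, decide_eq_iff_iff]

theorem hasTwoTp_iff {a b : M} {η : TwoTp m} : HasTwoTp n a b η ↔ twoTp n m a b = η := by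
  simp only [HasTwoTp, twoTp, Prod.ext_iff, funext_iff, decide_eq_iff_iff]

theorem twoTp_fst_iff {a b : M} {t : Fin m} :
    (twoTp n m a b).1 t = true ↔ HoldsR (n := n) t a b :=
  (hasTwoTp_iff.mpr rfl).1 t

theorem exists_sees {a b : M} {t : Fin m} (h : HoldsR (n := n) t a b) (hab : a ≠ b) :
    ∃ q : AudTp m × OneTp n m, q.1.1.1 t = true ∧ Sees a q b := by
  have ht := twoTp_fst_iff.mpr h
  refine ⟨(⟨twoTp n m a b, fun hs => ?_⟩, oneTp n m b), ht, hab, rfl, rfl⟩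
  rw [hs] at ht
  exact Bool.false_ne_true ht

theorem Sees.unique {a b : M} {q q' : AudTp m × OneTp n m} (h : Sees a q b) (h' : Sees a q' b) :
    q = q' :=
  Prod.ext (Subtype.ext (h.2.1.symm.trans h'.2.1)) (h.2.2.symm.trans h'.2.2)

theorem behavior_ne_zero_iff [Finite M] {a : M} {q : AudTp m × OneTp n m} :
    behavior n m a q ≠ 0 ↔ ∃ b, Sees a q b := by
  rw [behavior, Nat.card_ne_zero, nonempty_subtype, and_iff_left (Subtype.finite)]

theorem card_successors [Finite M] (t : Fin m) (a : M) :
    Nat.card {b : M // HoldsR (n := n) t a b ∧ a ≠ b} =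
      ∑ q with q.1.1.1 t = true, behavior n m a q := by
  have hsees (q : {q : AudTp m × OneTp n m // q.1.1.1 t = true}) (b : M) (h : Sees a q.1 b) :
      HoldsR (n := n) t a b ∧ a ≠ b :=
    ⟨twoTp_fst_iff.mp (h.2.1 ▸ q.2), h.1⟩
  rw [Finset.sum_subtype _ fun _ => Finset.mem_filter_univ _]
  refine (Nat.card_congr (Equiv.ofBijective
    (fun p => ⟨p.2.1, hsees p.1 p.2.1 p.2.2⟩) ⟨?_, ?_⟩)).symm.trans Nat.card_sigma
  · rintro ⟨⟨q, hq⟩, b, hb⟩ ⟨⟨q', hq'⟩, b', hb'⟩ h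
    obtain rfl : b = b' := congrArg Subtype.val h
    obtain rfl := hb.unique hb'
    rfl
  · rintro ⟨b, h, hab⟩
    obtain ⟨q, hq, hb⟩ := exists_sees h hab
    exact ⟨⟨⟨q, hq⟩, b, hb⟩, rfl⟩

theorem AudTp.exists_holds (η : AudTp m) : ∃ t, η.1.1 t = true ∨ η.1.2 t = true := by
  by_contra! h
  simp only [ne_eq, Bool.not_eq_true] at h
  exact η.2 (Prod.ext (funext fun t => (h t).1) (funext fun t => (h t).2))

theorem exists_behavior_ne_zero_iff [Finite M] :
    (∃ a : M, behavior n m a ≠ 0) ↔ ∃ (t : Fin m) (a b : M), a ≠ b ∧ HoldsR (n := n) t a b := by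
  simp only [Function.ne_iff, Pi.zero_apply, behavior_ne_zero_iff]
  constructor
  · rintro ⟨a, q, b, hab, hq, -⟩
    obtain ⟨t, ht | ht⟩ := q.1.exists_holds
    · exact ⟨t, a, b, hab, twoTp_fst_iff.mp (hq ▸ ht)⟩
    · exact ⟨t, b, a, hab.symm, ((hasTwoTp_iff.mpr hq).2 t).mp ht⟩
  · rintro ⟨t, a, b, hab, h⟩
    obtain ⟨q, -, hq⟩ := exists_sees h hab
    exact ⟨a, q, b, hq⟩

end Types

namespace NormalForm

variable {n m : ℕ} {φ : NormalForm n m}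

theorem mem_behaviors_iff {π : OneTp n m} {b : AudTp m × OneTp n m → ℕ} :
    b ∈ φ.behaviors π ↔
      (∀ q, b q ≠ 0 → φ.Compat₁ q.2 ∧ φ.Compat₂ π q.1.1 q.2) ∧
      ∀ i, π.1 i = true → (φ.rel i).Holds
        (∑ t, φ.coeff i t * ↑(∑ q with q.1.1.1 t = true, b q)) (φ.δ i) := by
  have hcompat (p : {p : AudTp m × OneTp n m // ¬ (φ.Compat₁ p.2 ∧ φ.Compat₂ π p.1.1 p.2)}) :
      natMulVec (φ.charSystem π).A b (.inl p) = b p.1 := by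
    simp [natMulVec_apply, charSystem]
  have hcount (i : {i : Fin n // π.1 i = true}) :
      natMulVec (φ.charSystem π).A b (.inr i) =
        ∑ t, φ.coeff i t * ↑(∑ q with q.1.1.1 t = true, b q) := by
    simp only [natMulVec_apply, charSystem, Matrix.of_apply, Finset.sum_mul, Finset.sum_filter,
      Nat.cast_sum, Finset.mul_sum]
    rw [Finset.sum_comm]
    refine Finset.sum_congr rfl fun t _ => Finset.sum_congr rfl fun q _ => ?_
    split_ifs <;> simp
  refine Sum.forall.trans (and_congr ?_ ?_)
  · exact Subtype.forall.trans (forall_congr' fun q => (forall_congr' fun hq =>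
      (Eq.congr_left (hcompat ⟨q, hq⟩)).trans Nat.cast_eq_zero).trans
        (not_imp_comm (b := b q = 0)))
  · exact Subtype.forall.trans (forall₂_congr fun i hi =>
      iff_of_eq (congrArg (fun z => (φ.rel i).Holds z (φ.δ i)) (hcount ⟨i, hi⟩)))

variable {M : Type} [Finite M] [(voc n m).Structure M]

theorem compat₁_oneTp_iff {a : M} : φ.Compat₁ (oneTp n m a) ↔ φ.γ.Realize ![a] :=
  ⟨fun h => h M a (hasOneTp_iff.mpr rfl),
    fun h _ _ _ _ hb => (realize_iff_of_hasOneTp φ.γ_qf (hasOneTp_iff.mpr rfl) hb).mp h⟩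

theorem entails₂_iff {a b : M} (hab : a ≠ b) :
    φ.Entails₂ (oneTp n m a) (twoTp n m a b) (oneTp n m b) ↔
      ∀ i, HoldsR (n := n) i a b → (φ.α i).Realize ![a, b] := by
  refine ⟨fun h i hi => h M a b (hasOneTp_iff.mpr rfl) (hasTwoTp_iff.mpr rfl)
    (hasOneTp_iff.mpr rfl) i ⟨hi, hab⟩, fun h N _ _ a' b' ha' hab' hb' i hi => ?_⟩
  exact (realize_iff_of_hasTwoTp (φ.α_qf i) (hasOneTp_iff.mpr rfl) ha' (hasTwoTp_iff.mpr rfl) hab'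
    (hasOneTp_iff.mpr rfl) hb' hab hi.2).mp (h i (twoTp_fst_iff.mp ((hab'.1 i).mpr hi.1)))

/-- The local conditions of `φ` on vertices with 1-types `tp` and behaviors `bh`. -/
def IsAdmissible (φ : NormalForm n m) {V : Type} (tp : V → OneTp n m)
    (bh : V → AudTp m × OneTp n m → ℕ) : Prop :=
  ∀ v, φ.Compat₁ (tp v) ∧ bh v ∈ φ.behaviors (tp v)

theorem models_iff : φ.Models M ↔ φ.IsAdmissible (oneTp n m) (behavior n m (M := M)) := by
  have hU (i : Fin n) (a : M) : (oneTp n m a).1 i = true ↔ HoldsU (m := m) i a :=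
    (hasOneTp_iff.mpr rfl).1 i
  constructor
  · rintro ⟨hγ, hα, hP⟩ a
    refine ⟨compat₁_oneTp_iff.mpr (hγ a), mem_behaviors_iff.mpr ⟨fun q hq => ?_, fun i hi => ?_⟩⟩
    · obtain ⟨b, hab, htwo, hone⟩ := behavior_ne_zero_iff.mp hq
      rw [← htwo, ← hone]
      exact ⟨compat₁_oneTp_iff.mpr (hγ b), (entails₂_iff hab).mpr fun i hi => hα i a b ⟨hi, hab⟩,
        (entails₂_iff hab.symm).mpr fun i hi => hα i b a ⟨hi, hab.symm⟩⟩
    · simpa only [card_successors] using hP i a ((hU i a).mp hi)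
  · refine fun h => ⟨fun a => compat₁_oneTp_iff.mp (h a).1, fun i a b ⟨hi, hab⟩ => ?_,
      fun i a hi => ?_⟩
    · obtain ⟨q, -, hq⟩ := exists_sees hi hab
      have hent := ((mem_behaviors_iff.mp (h a).2).1 q (behavior_ne_zero_iff.mpr ⟨b, hq⟩)).2.1
      rw [← hq.2.1, ← hq.2.2, entails₂_iff hab] at hent
      exact hent i hi
    · simpa only [card_successors] using (mem_behaviors_iff.mp (h a).2).2 i ((hU i a).mpr hi)

end NormalForm

/-! ### Realization of behaviors -/

section Involution

theorem exists_rank {S K : Type*} [Finite S] (cls : S → K) :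
    ∃ r : S → ℕ, ∀ k, Set.BijOn r {s | cls s = k} (Set.Iio (Nat.card {s // cls s = k})) := by
  let e (k : K) := Finite.equivFin {s // cls s = k}
  refine ⟨fun s => e (cls s) ⟨s, rfl⟩, fun k => ?_⟩
  have he (s : S) (hs : cls s = k) : (e (cls s) ⟨s, rfl⟩ : ℕ) = e k ⟨s, hs⟩ := by
    subst hs
    rfl
  refine ⟨fun s hs => (he s hs).trans_lt (e k ⟨s, hs⟩).isLt, fun s hs s' hs' h => ?_,
    fun j hj => ⟨(e k).symm ⟨j, hj⟩, ((e k).symm ⟨j, hj⟩).2, ?_⟩⟩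
  · have h' := (he s hs).symm.trans (h.trans (he s' hs'))
    exact congrArg Subtype.val ((e k).injective (Fin.ext h'))
  · exact (he _ ((e k).symm ⟨j, hj⟩).2).trans (congrArg Fin.val ((e k).apply_symm_apply _))

theorem exists_involutive_swapping {S K : Type*} [Finite S] (cls : S → K) {bar : K → K}
    (hbar : Function.Involutive bar)
    (hcard : ∀ k, Nat.card {s // cls s = k} = Nat.card {s // cls s = bar k}) :
    ∃ σ : S → S, Function.Involutive σ ∧ ∀ s, cls (σ s) = bar (cls s) := by
  obtain ⟨r, hr⟩ := exists_rank cls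
  have hσ (s : S) : ∃ s', cls s' = bar (cls s) ∧ r s' = r s :=
    (hr _).surjOn (hcard (cls s) ▸ (hr _).mapsTo rfl)
  choose σ hcls hrank using hσ
  refine ⟨σ, fun s => (hr (cls s)).injOn ?_ rfl ?_, hcls⟩
  · rw [Set.mem_ofPred_eq, hcls, hcls, hbar]
  · rw [hrank, hrank]

end Involution

section Shift

variable {D : Type} {σ : D → D}

open Classical in
/-- Distinct nonzero elements of an abelian group such that the involution `σ` acts on them by
negation. -/
def shift (σ : D → D) (d : D) : D → ZMod 4 :=
  if σ d = d then Pi.single d 2 else Pi.single (σ d) 1 - Pi.single d 1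

theorem shift_involutive (hσ : Function.Involutive σ) (d : D) : shift σ (σ d) = -shift σ d := by
  classical
  rw [shift, shift, hσ]
  by_cases h : σ d = d
  · rw [if_pos h.symm, if_pos h, h, ← Pi.single_neg]
    rfl
  · rw [if_neg (Ne.symm h), if_neg h, neg_sub]

theorem shift_apply_mem_iff (d e : D) : shift σ d e ∈ ({2, 3} : Set (ZMod 4)) ↔ e = d := by
  classical
  have h0 : (0 : ZMod 4) ∉ ({2, 3} : Set (ZMod 4)) := by decide
  have h1 : (1 : ZMod 4) ∉ ({2, 3} : Set (ZMod 4)) := by decide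
  have h2 : (2 : ZMod 4) ∈ ({2, 3} : Set (ZMod 4)) := by decide
  have h3 : (-1 : ZMod 4) ∈ ({2, 3} : Set (ZMod 4)) := by decide
  rw [shift]
  split_ifs with hd
  · obtain rfl | he := eq_or_ne e d
    · simpa only [Pi.single_eq_same, iff_true] using h2
    · simpa only [Pi.single_eq_of_ne he, he, iff_false] using h0
  · obtain rfl | he := eq_or_ne e d
    · simpa only [Pi.sub_apply, Pi.single_eq_same, Pi.single_eq_of_ne' hd, zero_sub, iff_true]
        using h3
    · obtain rfl | he' := eq_or_ne e (σ d)
      · simpa only [Pi.sub_apply, Pi.single_eq_same, Pi.single_eq_of_ne hd, sub_zero, hd,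
          iff_false] using h1
      · simpa only [Pi.sub_apply, Pi.single_eq_of_ne he, Pi.single_eq_of_ne he', sub_zero, he,
          iff_false] using h0

theorem shift_injective : Function.Injective (shift σ) := fun d e h =>
  (shift_apply_mem_iff e d).mp (h ▸ (shift_apply_mem_iff d d).mpr rfl)

theorem shift_ne_zero (d : D) : shift σ d ≠ 0 := fun h => by
  have hd := (shift_apply_mem_iff (σ := σ) d d).mpr rfl
  rw [h, Pi.zero_apply] at hd
  revert hd
  decide

end Shift

/-- A multigraph with vertex set `V` and set of darts (directed edges) `D` whose vertices are
labelled with 1-types and whose darts are labelled with audible 2-types. A dart may be its own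
reverse. -/
structure DartGraph (n m : ℕ) (V D : Type) where
  /-- the 1-type of a vertex -/
  tp : V → OneTp n m
  /-- the vertex at which a dart starts -/
  src : D → V
  /-- the 2-type of a dart -/
  label : D → AudTp m
  /-- the reverse of a dart -/
  rev : D → D
  rev_rev : Function.Involutive rev
  label_rev : ∀ d, label (rev d) = (label d).dual

namespace DartGraph

variable {n m : ℕ} {V D : Type}

/-- The vertices of a covering graph of `G` in which there are neither loops nor multiple edges. -/
def Cover (_ : DartGraph n m V D) : Type := V × (D → ZMod 4)

instance (G : DartGraph n m V D) [Finite V] [Finite D] : Finite G.Cover :=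
  inferInstanceAs (Finite (V × (D → ZMod 4)))

variable {G : DartGraph n m V D} {d e : D} {a b : G.Cover}

/-- A lift of the dart `d` leads from `a` to `b`. -/
def Joins (G : DartGraph n m V D) (d : D) (a b : G.Cover) : Prop :=
  G.src d = a.1 ∧ G.src (G.rev d) = b.1 ∧ b.2 = a.2 + shift G.rev d

/-- The structure on the covering graph given by the labels of `G`. -/
instance : (voc n m).Structure G.Cover where
  funMap f := isEmptyElim f
  RelMap
    | .U i, v => (G.tp (v 0).1).1 i = true
    | .R i, v => v 0 = v 1 ∧ (G.tp (v 0).1).2 i = true ∨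
        ∃ d, G.Joins d (v 0) (v 1) ∧ (G.label d).1.1 i = true

theorem holdsR_iff {i : Fin m} : HoldsR (n := n) i a b ↔
    a = b ∧ (G.tp a.1).2 i = true ∨ ∃ d, G.Joins d a b ∧ (G.label d).1.1 i = true := Iff.rfl

theorem Joins.symm (h : G.Joins d a b) : G.Joins (G.rev d) b a := by
  refine ⟨h.2.1, by rw [G.rev_rev, h.1], ?_⟩
  rw [shift_involutive G.rev_rev, h.2.2, add_neg_cancel_right]

theorem Joins.ne (h : G.Joins d a b) : a ≠ b := by
  rintro rfl
  exact shift_ne_zero d (left_eq_add.mp h.2.2)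

theorem Joins.unique (h : G.Joins d a b) (h' : G.Joins e a b) : d = e :=
  shift_injective (add_left_cancel (h.2.2.symm.trans h'.2.2))

theorem Joins.holdsR_iff (h : G.Joins d a b) {i : Fin m} :
    HoldsR (n := n) i a b ↔ (G.label d).1.1 i = true := by
  rw [DartGraph.holdsR_iff, or_iff_right fun hab => h.ne hab.1]
  exact ⟨fun ⟨e, he, hi⟩ => h.unique he ▸ hi, fun hi => ⟨d, h, hi⟩⟩

theorem oneTp_eq (a : G.Cover) : oneTp n m a = G.tp a.1 := by
  refine hasOneTp_iff.mp ⟨fun i => Iff.rfl, fun i => ?_⟩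
  rw [holdsR_iff, or_iff_left fun ⟨d, hd, _⟩ => hd.ne rfl, and_iff_right rfl]

theorem Joins.twoTp_eq (h : G.Joins d a b) : twoTp n m a b = G.label d := by
  refine hasTwoTp_iff.mp ⟨fun i => h.holdsR_iff.symm, fun i => ?_⟩
  rw [h.symm.holdsR_iff, G.label_rev]
  rfl

theorem sees_iff {q : AudTp m × OneTp n m} :
    Sees a q b ↔ ∃ d, G.Joins d a b ∧ G.label d = q.1 ∧ G.tp (G.src (G.rev d)) = q.2 := by
  have hjoins (hab : a ≠ b) (htwo : twoTp n m a b = q.1.1) : ∃ d, G.Joins d a b := by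
    obtain ⟨t, ht | ht⟩ := q.1.exists_holds
    · obtain ⟨hab', -⟩ | ⟨d, hd, -⟩ := ((hasTwoTp_iff.mpr htwo).1 t).mp ht
      · exact absurd hab' hab
      · exact ⟨d, hd⟩
    · obtain ⟨hab', -⟩ | ⟨d, hd, -⟩ := ((hasTwoTp_iff.mpr htwo).2 t).mp ht
      · exact absurd hab'.symm hab
      · exact ⟨_, hd.symm⟩
  constructor
  · rintro ⟨hab, htwo, hone⟩
    obtain ⟨d, hd⟩ := hjoins hab htwo
    exact ⟨d, hd, Subtype.ext (hd.twoTp_eq.symm.trans htwo), by rw [hd.2.1, ← oneTp_eq, hone]⟩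
  · rintro ⟨d, hd, hlabel, htp⟩
    exact ⟨hd.ne, by rw [hd.twoTp_eq, hlabel], by rw [oneTp_eq, ← hd.2.1, htp]⟩

theorem behavior_eq (a : G.Cover) (q : AudTp m × OneTp n m) :
    behavior n m a q =
      Nat.card {d // G.src d = a.1 ∧ G.label d = q.1 ∧ G.tp (G.src (G.rev d)) = q.2} := by
  let f (d : {d // G.src d = a.1 ∧ G.label d = q.1 ∧ G.tp (G.src (G.rev d)) = q.2}) :
      {b // Sees a q b} :=
    ⟨(G.src (G.rev d), a.2 + shift G.rev d), sees_iff.mpr ⟨d, ⟨d.2.1, rfl, rfl⟩, d.2.2⟩⟩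
  refine (Nat.card_congr (Equiv.ofBijective f ⟨fun d e h => ?_, ?_⟩)).symm
  · exact Subtype.ext (shift_injective (add_left_cancel (congrArg (fun b => b.1.2) h)))
  · rintro ⟨b, hb⟩
    obtain ⟨d, hd, hq⟩ := sees_iff.mp hb
    exact ⟨⟨d, hd.1, hq⟩, Subtype.ext (Prod.ext hd.2.1 hd.2.2.symm)⟩

end DartGraph

/-! ### Balanced families of behaviors -/

section Balance

variable {n m : ℕ} {V : Type} {tp : V → OneTp n m} {bh : V → AudTp m × OneTp n m → ℕ}

/-- The darts at the vertices of a graph in which the vertices have the behaviors `bh`. -/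
abbrev Stub (bh : V → AudTp m × OneTp n m → ℕ) : Type :=
  Σ p : V × (AudTp m × OneTp n m), Fin (bh p.1 p.2)

theorem card_stub_eq (v : V) (q : AudTp m × OneTp n m) :
    Nat.card {d : Stub bh // d.1 = (v, q)} = bh v q :=
  (Nat.card_congr (Equiv.sigmaSubtype (v, q))).trans (Nat.card_fin _)

variable [Fintype V]

/-- The total number of elements that vertices of 1-type `π` are required to see in the way `q`,
for vertices with 1-types `tp` and behaviors `bh`. -/
def flux (tp : V → OneTp n m) (bh : V → AudTp m × OneTp n m → ℕ) (π : OneTp n m)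
    (q : AudTp m × OneTp n m) : ℕ :=
  ∑ v with tp v = π, bh v q

/-- The matching condition for vertices with 1-types `tp` and behaviors `bh`: seeing has to be
symmetric up to dualizing the 2-type. -/
def IsBalanced (tp : V → OneTp n m) (bh : V → AudTp m × OneTp n m → ℕ) : Prop :=
  ∀ π η π', flux tp bh π (η, π') = flux tp bh π' (η.dual, π)

theorem flux_behavior {M : Type} [Fintype M] [(voc n m).Structure M] (π : OneTp n m)
    (q : AudTp m × OneTp n m) :
    flux (oneTp n m) (behavior n m (M := M)) π q =
      Nat.card {p : M × M // oneTp n m p.1 = π ∧ Sees p.1 q p.2} := by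
  rw [Nat.card_congr (Equiv.subtypeProdEquivSigmaSubtype
    fun a b : M => oneTp n m a = π ∧ Sees a q b), Nat.card_sigma, flux, Finset.sum_filter]
  refine Finset.sum_congr rfl fun a _ => ?_
  split_ifs with ha <;> simp [ha, behavior]

theorem isBalanced_behavior {M : Type} [Fintype M] [(voc n m).Structure M] :
    IsBalanced (oneTp n m) (behavior n m (M := M)) := by
  intro π η π'
  rw [flux_behavior, flux_behavior]
  refine Nat.card_congr ((Equiv.prodComm M M).subtypeEquiv fun ⟨a, b⟩ => ?_)
  constructor
  · rintro ⟨ha, hab, htwo, hb⟩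
    exact ⟨hb, hab.symm, congrArg dual htwo, ha⟩
  · rintro ⟨hb, hba, htwo, ha⟩
    exact ⟨ha, hba.symm, congrArg dual htwo, hb⟩

theorem card_stub_class_eq (π : OneTp n m) (q : AudTp m × OneTp n m) :
    Nat.card {d : Stub bh // (tp d.1.1, d.1.2) = (π, q)} = flux tp bh π q := by
  classical
  have hmem (p : V × (AudTp m × OneTp n m)) :
      p ∈ Finset.univ.filter (tp · = π) ×ˢ {q} ↔ (tp p.1, p.2) = (π, q) := by
    rw [Finset.mem_product, Finset.mem_filter_univ, Finset.mem_singleton, ← Prod.mk_inj]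
  calc Nat.card {d : Stub bh // (tp d.1.1, d.1.2) = (π, q)}
      = Nat.card (Σ p : {p : V × (AudTp m × OneTp n m) // (tp p.1, p.2) = (π, q)},
          Fin (bh p.1.1 p.1.2)) :=
        Nat.card_congr (Equiv.subtypeSigmaEquiv _
          fun p : V × (AudTp m × OneTp n m) => (tp p.1, p.2) = (π, q))
    _ = ∑ p : {p : V × (AudTp m × OneTp n m) // (tp p.1, p.2) = (π, q)}, bh p.1.1 p.1.2 :=
        Nat.card_sigma.trans (Finset.sum_congr rfl fun p _ => Nat.card_fin _)
    _ = flux tp bh π q := by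
        rw [← Finset.sum_subtype _ hmem fun p => bh p.1 p.2, Finset.sum_product]
        exact Finset.sum_congr rfl fun v _ => Finset.sum_singleton _ _

theorem IsBalanced.exists_dartGraph (h : IsBalanced tp bh) :
    ∃ G : DartGraph n m V (Stub bh), G.tp = tp ∧
      ∀ d, (G.src d, G.label d, G.tp (G.src (G.rev d))) = d.1 := by
  obtain ⟨σ, hσ, hcls⟩ := exists_involutive_swapping
    (fun d : Stub bh => (tp d.1.1, d.1.2)) (bar := fun k => (k.2.2, k.2.1.dual, k.1))
    (fun _ => rfl) fun ⟨π, η, π'⟩ => by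
      simpa only [card_stub_class_eq] using h π η π'
  exact ⟨⟨tp, fun d => d.1.1, fun d => d.1.2.1, σ, hσ, fun d => congrArg (·.2.1) (hcls d)⟩, rfl,
    fun d => Prod.ext rfl (Prod.ext rfl (congrArg Prod.fst (hcls d)))⟩

theorem IsBalanced.exists_structure (h : IsBalanced tp bh) :
    ∃ (M : Type) (_ : Finite M) (_ : (voc n m).Structure M) (own : M → V),
      Function.Surjective own ∧
        ∀ a, oneTp n m a = tp (own a) ∧ behavior n m a = bh (own a) := by
  obtain ⟨G, rfl, hG⟩ := h.exists_dartGraph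
  refine ⟨G.Cover, inferInstance, inferInstance, Prod.fst, Prod.fst_surjective, fun a =>
    ⟨G.oneTp_eq a, funext fun q => (G.behavior_eq a q).trans ?_⟩⟩
  rw [← card_stub_eq (bh := bh)]
  refine Nat.card_congr (Equiv.subtypeEquivRight fun d => ?_)
  exact (and_congr_right' Prod.mk_inj.symm).trans (Prod.mk_inj.symm.trans (by rw [hG]))

end Balance

/-! ### Solutions of `Q^φ` -/

namespace NormalForm

variable {n m : ℕ} {φ : NormalForm n m}

theorem row_apply {x : φ.CompatTp → AudTp m → φ.CompatTp → ℕ} (π : φ.CompatTp) (η : AudTp m)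
    (π' : φ.CompatTp) : φ.row x π (η, π'.1) = x π η π' :=
  dif_pos π'.2

section Flux

variable {V : Type} [Fintype V] {tp : V → OneTp n m} {bh : V → AudTp m × OneTp n m → ℕ}

theorem IsAdmissible.flux_eq_zero_of_not_compat (h : φ.IsAdmissible tp bh) {π : OneTp n m}
    {q : AudTp m × OneTp n m} (hq : ¬ (φ.Compat₁ π ∧ φ.Compat₁ q.2)) : flux tp bh π q = 0 := by
  refine Finset.sum_eq_zero fun v hv => by_contra fun hvq => hq ⟨?_, ?_⟩
  · exact (Finset.mem_filter_univ v).mp hv ▸ (h v).1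
  · exact ((mem_behaviors_iff.mp (h v).2).1 q hvq).1

theorem IsAdmissible.row_flux (h : φ.IsAdmissible tp bh) (π : φ.CompatTp) :
    φ.row (fun π η π' => flux tp bh π.1 (η, π'.1)) π = ∑ v with tp v = π.1, bh v := by
  funext q
  rw [Finset.sum_apply, row]
  split_ifs with hq
  · rfl
  · exact (h.flux_eq_zero_of_not_compat fun h' => hq h'.2).symm

theorem IsAdmissible.isSolutionQ (h : φ.IsAdmissible tp bh) (hbal : IsBalanced tp bh)
    (hne : ∃ v, bh v ≠ 0) : φ.IsSolutionQ fun π η π' => flux tp bh π.1 (η, π'.1) where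
  structural π := by
    rw [LinSystem.tildeSol_iff_mem_closure, h.row_flux]
    refine AddSubmonoid.sum_mem _ fun v hv => AddSubmonoid.subset_closure ?_
    exact (Finset.mem_filter_univ v).mp hv ▸ (h v).2
  matching π η π' := hbal π.1 η π'.1
  nontrivial := by
    obtain ⟨v, hv⟩ := hne
    obtain ⟨q, hq⟩ := Function.ne_iff.mp hv
    refine Nat.pos_of_ne_zero fun h0 => hq ?_
    simp only [flux, Finset.sum_eq_zero_iff, Finset.mem_univ, Finset.mem_filter_univ,
      true_imp_iff] at h0
    exact h0 ⟨tp v, (h v).1⟩ q.1 ⟨q.2, ((mem_behaviors_iff.mp (h v).2).1 q hq).1⟩ v rfl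

end Flux

variable {x : φ.CompatTp → AudTp m → φ.CompatTp → ℕ}

theorem IsSolutionQ.exists_isAdmissible (hx : φ.IsSolutionQ x) :
    ∃ (V : Type) (_ : Fintype V) (tp : V → OneTp n m) (bh : V → AudTp m × OneTp n m → ℕ),
      φ.IsAdmissible tp bh ∧ ∀ π : φ.CompatTp, ∑ v with tp v = π.1, bh v = φ.row x π := by
  choose l hl hsum using fun π => AddSubmonoid.exists_list_of_mem_closure
    ((LinSystem.tildeSol_iff_mem_closure _).mp (hx.structural π))
  refine ⟨Σ π : φ.CompatTp, Fin (l π).length, inferInstance, fun v => v.1.1, fun v => (l v.1)[v.2],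
    fun v => ⟨v.1.2, hl _ _ (List.getElem_mem _)⟩, fun π => ?_⟩
  rw [Finset.sum_filter, Fintype.sum_sigma, Fintype.sum_eq_single π fun π' hπ' => ?_, ← hsum]
  · simp
  · simp [Subtype.val_injective.ne hπ']

theorem IsSolutionQ.isBalanced (hx : φ.IsSolutionQ x) {V : Type} [Fintype V]
    {tp : V → OneTp n m} {bh : V → AudTp m × OneTp n m → ℕ} (h : φ.IsAdmissible tp bh)
    (hrow : ∀ π : φ.CompatTp, ∑ v with tp v = π.1, bh v = φ.row x π) : IsBalanced tp bh := by
  have hflux (π : φ.CompatTp) (η : AudTp m) (π' : φ.CompatTp) :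
      flux tp bh π.1 (η, π'.1) = x π η π' := by
    rw [← row_apply (x := x), ← hrow, Finset.sum_apply, flux]
  intro π η π'
  by_cases hπ : φ.Compat₁ π ∧ φ.Compat₁ π'
  · have hmatch := hx.matching ⟨π, hπ.1⟩ η ⟨π', hπ.2⟩
    rwa [← hflux, ← hflux] at hmatch
  · rw [h.flux_eq_zero_of_not_compat hπ, h.flux_eq_zero_of_not_compat fun h' => hπ h'.symm]

theorem IsSolutionQ.exists_row_ne_zero (hx : φ.IsSolutionQ x) : ∃ π, φ.row x π ≠ 0 := by
  by_contra! h
  refine hx.nontrivial.ne' (Finset.sum_eq_zero fun π _ => Finset.sum_eq_zero fun η _ =>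
    Finset.sum_eq_zero fun π' _ => ?_)
  rw [← row_apply (x := x), h, Pi.zero_apply]

theorem finitelySatisfiable_iff_exists_edge
    (hφ : ∀ π : OneTp n m, φ.Compat₁ π → 0 ∉ φ.behaviors π) :
    φ.FinitelySatisfiable ↔ ∃ (M : Type) (_ : Finite M) (_ : (voc n m).Structure M),
      φ.Models M ∧ ∃ (t : Fin m) (a b : M), a ≠ b ∧ HoldsR (n := n) t a b := by
  constructor
  · rintro ⟨M, _, ⟨a⟩, _, hM⟩
    have ha := models_iff.mp hM a
    exact ⟨M, _, _, hM, exists_behavior_ne_zero_iff.mp ⟨a, fun h0 => hφ _ ha.1 (h0 ▸ ha.2)⟩⟩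
  · rintro ⟨M, _, _, hM, _, a, -⟩
    exact ⟨M, _, ⟨a⟩, _, hM⟩

end NormalForm

end GP2

end

theorem lemma4p5_general {n m : ℕ} (φ : GP2.NormalForm n m) :
    (∃ (M : Type) (_ : Finite M) (_ : (GP2.voc n m).Structure M),
      φ.Models M ∧ ∃ (t : Fin m) (a b : M), a ≠ b ∧ GP2.HoldsR (n := n) t a b) ↔
      ∃ x : φ.CompatTp → GP2.AudTp m → φ.CompatTp → ℕ, φ.IsSolutionQ x := by
  constructor
  · rintro ⟨M, _, _, hM, hedge⟩
    have := Fintype.ofFinite M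
    exact ⟨_, (GP2.NormalForm.models_iff.mp hM).isSolutionQ GP2.isBalanced_behavior
      (GP2.exists_behavior_ne_zero_iff.mpr hedge)⟩
  · rintro ⟨x, hx⟩
    obtain ⟨V, _, tp, bh, hadm, hrow⟩ := hx.exists_isAdmissible
    obtain ⟨M, _, _, own, hown, hM⟩ := (hx.isBalanced hadm hrow).exists_structure
    obtain ⟨π, hπ⟩ := hx.exists_row_ne_zero
    obtain ⟨v, -, hv⟩ := Finset.exists_ne_zero_of_sum_ne_zero (hrow π ▸ hπ)
    obtain ⟨a, rfl⟩ := hown v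
    refine ⟨M, inferInstance, inferInstance, GP2.NormalForm.models_iff.mpr fun a => ?_,
      GP2.exists_behavior_ne_zero_iff.mp ⟨a, (hM a).2 ▸ hv⟩⟩
    rw [(hM a).1, (hM a).2]
    exact hadm (own a)

theorem lemma4p5 {n m : ℕ} (φ : GP2.NormalForm n m)
    (hφ : ∀ π : GP2.OneTp n m, φ.Compat₁ π → (0 : GP2.AudTp m × GP2.OneTp n m → ℕ) ∉ φ.behaviors π) :
    φ.FinitelySatisfiable ↔
      ∃ x : φ.CompatTp → GP2.AudTp m → φ.CompatTp → ℕ, φ.IsSolutionQ x :=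
  (GP2.NormalForm.finitelySatisfiable_iff_exists_edge hφ).trans (lemma4p5_general φ)
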